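/- Let $X$ be a complex Hilbert space, $Y$ a complex Banach space, and let $-A$ be the generator of a strongly continuous semigroup of contractions $(T(t))_{t\ge 0}$ on $X$. Let $D(A)$ and $R(A)$ denote the domain and the range of $A$, and let $C : D(A) \to Y$ be linear and bounded when $D(A)$ carries the graph norm $\|x\| + \|Ax\|$. Assume that $R(A)$ is dense in $X$ (then $A$ is injective, and for $x \in R(A)$ the fractional power $$A^{-1/2}x = \frac1\pi \int_0^\infty s^{-1/2}(s+A)^{-1}x\,ds$$ is well defined, with $A^{-1/2}x \in D(A)$ if $x \in D(A)\cap R(A)$), and that there is a constant $\delta > 0$ such that $$\|CA^{-1/2}x\|_Y \ge \delta \|x\| \qquad \text{for all } x \in D(A)\cap R(A).$$ Then there is a constant $m>0$ such that $$m^2\|x\|^2 \le \int_0^\infty \|CT(t)x\|_Y^2\,dt \qquad \text{for all } x \in D(A)\cap R(A).$$ If, in addition, either $A$ is boundedly invertible (that is, $0$ lies in the resolvent set of $A$) or $C$ is infinite-time admissible for $A$, that is, $$\sup_{x\in D(A),\ \|x\|=1} \int_0^\infty \|CT(t)x\|_Y^2\,dt < \infty,$$ then $C$ is exactly observable in infinite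 time for $A$, that is, $$\inf_{x\in D(A),\ \|x\|=1} \int_0^\infty \|CT(t)x\|_Y^2\,dt > 0.$$ (The integrals take values in $[0,\infty]$; the infimum may be $+\infty$.) -/

import Mathlib

open MeasureTheory Filter Topology
open scoped ENNReal

noncomputable section

namespace Observability

variable {X Y : Type*} [NormedAddCommGroup X] [InnerProductSpace ℂ X]
  [NormedAddCommGroup Y] [NormedSpace ℂ Y]

/-- A strongly continuous semigroup of contractions `(T t)_{t ≥ 0}` on `X`. Only the values at
`t ≥ 0` matter. -/
structure IsContractionSemigroup (T : ℝ → X →L[ℂ] X) : Prop where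
  map_zero : T 0 = ContinuousLinearMap.id ℂ X
  map_add : ∀ s t : ℝ, 0 ≤ s → 0 ≤ t → T (s + t) = (T s).comp (T t)
  continuousOn : ∀ x : X, ContinuousOn (fun t => T t x) (Set.Ici 0)
  norm_le_one : ∀ t : ℝ, 0 ≤ t → ‖T t‖ ≤ 1

/-- `G` is the generator of `T`: its domain consists of exactly those `x` for which
`lim_{t → 0+} (T t x - x) / t` exists, and `G x` is that limit. -/
def IsGenerator (T : ℝ → X →L[ℂ] X) (G : X →ₗ.[ℂ] X) : Prop :=
  ∀ x y : X, (x, y) ∈ G.graph ↔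
    Tendsto (fun t : ℝ => t⁻¹ • (T t x - x)) (𝓝[>] 0) (𝓝 y)

/-- The range `R(A)` of an unbounded operator. -/
def opRange (A : X →ₗ.[ℂ] X) : Submodule ℂ X := LinearMap.range A.toFun

/-- `A` is (boundedly) invertible, i.e. `0` belongs to the resolvent set of `A`. -/
def IsBoundedlyInvertible (A : X →ₗ.[ℂ] X) : Prop :=
  ∃ B : X →L[ℂ] X, (∀ x : A.domain, B (A x) = x) ∧
    ∀ y : X, ∃ h : B y ∈ A.domain, A ⟨B y, h⟩ = y

/-- `C : D(A) → Y` is bounded when `D(A)` carries the graph norm `‖x‖ + ‖A x‖`. -/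
def IsGraphBounded (A : X →ₗ.[ℂ] X) (C : A.domain →ₗ[ℂ] Y) : Prop :=
  ∃ K : ℝ, ∀ x : A.domain, ‖C x‖ ≤ K * (‖(x : X)‖ + ‖A x‖)

/-- `(s + A)⁻¹ x`, the inverse of the map `D(A) → X, y ↦ s y + A y`. If `-A` generates a
contraction semigroup, this map is a bijection for every `s > 0`. -/
def resolventAt (A : X →ₗ.[ℂ] X) (s : ℝ) : X → A.domain :=
  Function.invFun (fun y : A.domain => s • (y : X) + A y)

/-- `A^{-1/2} x` for `x ∈ R(A)`, by Balakrishnan's formula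
`A^{-1/2} x = π⁻¹ ∫_0^∞ s^{-1/2} (s + A)⁻¹ x ds`. If `-A` generates a contraction semigroup and
`A` is injective, the integral converges absolutely for every `x ∈ R(A) = D(A⁻¹)`, and it is the
usual Balakrishnan definition of the fractional power `(A⁻¹)^{1/2}` on `D(A⁻¹)`. -/
def negSqrt (A : X →ₗ.[ℂ] X) (x : X) : X :=
  (Real.pi)⁻¹ • ∫ s in Set.Ioi (0 : ℝ), (s ^ (-(1 / 2) : ℝ)) • (resolventAt A s x : X)

/-- The domain of the generator is invariant under the semigroup. -/
theorem IsGenerator.apply_mem_domain {T : ℝ → X →L[ℂ] X} (hT : IsContractionSemigroup T)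
    {A : X →ₗ.[ℂ] X} (hA : IsGenerator T (-A)) {x : X} (hx : x ∈ A.domain) {t : ℝ}
    (ht : 0 ≤ t) : T t x ∈ A.domain := by
  have h1 : (x, (-A) ⟨x, hx⟩) ∈ (-A).graph := (-A).mem_graph ⟨x, hx⟩
  have h2 := (hA _ _).1 h1
  have h3 : (T t x, T t ((-A) ⟨x, hx⟩)) ∈ (-A).graph := by
    rw [hA]
    refine (((T t).continuous.tendsto _).comp h2).congr' ?_
    filter_upwards [self_mem_nhdsWithin] with s hs
    have hs' : (0 : ℝ) ≤ s := le_of_lt hs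
    have e : T t (T s x) = T s (T t x) := by
      have e1 := hT.map_add t s ht hs'
      have e2 := hT.map_add s t hs' ht
      rw [add_comm, e2] at e1
      exact (congrArg (fun L : X →L[ℂ] X => L x) e1).symm
    simp [e]
  have h4 : T t x ∈ (-A).domain := LinearPMap.mem_domain_of_mem_graph h3
  exact h4

open Classical in
/-- The output `t ↦ C T(t) x`. For `x ∈ D(A)` and `t ≥ 0` one always has `T(t) x ∈ D(A)`
(see `IsGenerator.apply_mem_domain`), so the second branch plays no role. -/
def output (A : X →ₗ.[ℂ] X) (C : A.domain →ₗ[ℂ] Y) (T : ℝ → X →L[ℂ] X) (x : X) (t : ℝ) : Y :=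
  if h : T t x ∈ A.domain then C ⟨T t x, h⟩ else 0

/-- `∫_0^∞ ‖C T(t) x‖² dt`, as an element of `[0, ∞]`. -/
def outputEnergy (A : X →ₗ.[ℂ] X) (C : A.domain →ₗ[ℂ] Y) (T : ℝ → X →L[ℂ] X) (x : X) : ℝ≥0∞ :=
  ∫⁻ t in Set.Ioi (0 : ℝ), ‖output A C T x t‖ₑ ^ 2

/-- Infinite-time admissibility: `sup {∫_0^∞ ‖C T(t) x‖² dt : x ∈ D(A), ‖x‖ = 1} < ∞`. -/
def IsInfiniteTimeAdmissible (A : X →ₗ.[ℂ] X) (C : A.domain →ₗ[ℂ] Y)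
    (T : ℝ → X →L[ℂ] X) : Prop :=
  (⨆ (x : X) (_ : x ∈ A.domain) (_ : ‖x‖ = 1), outputEnergy A C T x) < ∞

/-- Exact observability in infinite time:
`inf {∫_0^∞ ‖C T(t) x‖² dt : x ∈ D(A), ‖x‖ = 1} > 0`. -/
def IsInfiniteTimeExactlyObservable (A : X →ₗ.[ℂ] X) (C : A.domain →ₗ[ℂ] Y)
    (T : ℝ → X →L[ℂ] X) : Prop :=
  0 < ⨅ (x : X) (_ : x ∈ A.domain) (_ : ‖x‖ = 1), outputEnergy A C T x

end Observability

end

/-!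
Write `J_t = (1 + t A)⁻¹`, `D_t = J_t - J_{2t}` and `z_t = (T(t) - T(2t)) x`.

The vectors `z_t` lie in `R(A)`, and Balakrishnan's integral represents `A^{-1/2} z_t` by
`t^{1/2} ∫_0^∞ κ(w) T(t (1 + w)) x dw` with an integrable kernel `κ`: the cancellation in
`T(t) - T(2t)` makes `κ` integrable. The lower bound on `C A^{-1/2}` at `z_t` and Minkowski's
integral inequality therefore control `∫ ‖z_t‖² dt/t` by the output energy of `x`.

It remains to prove the square function estimate `‖x‖² ≤ 74 ∫ ‖z_t‖² dt/t`. Since `J_t` is the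
Laplace transform of `T`, it suffices to have it for `D_t x` in place of `z_t`. As `R(A)` is dense,
`J_t x → 0` for `t → ∞`, and Frullani's integral gives `∫ Re ⟪x, D_t x⟫ dt/t = log 2 · ‖x‖²`.
Accretivity gives `3 ‖D_t x‖² ≤ Re ⟪x, D_t x⟫`, and the same bound for the adjoint of `D_t`. By the
resolvent identity `21 D_t D_{4t} = 10 D_{2t} - 4 (D_t + D_{4t})`. Pairing this with `x` and
integrating against the dilation invariant measure `dt/t`, the right side contributes
`2 ∫ Re ⟪x, D_t x⟫ dt/t`, while on the left the factor `‖D_t* x‖` is absorbed and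
`∫ ‖D_{4t} x‖² dt/t` remains.
-/

noncomputable section

namespace Observability

open Set

section Lintegral

variable {α β : Type*} [MeasurableSpace α] [MeasurableSpace β] {μ : Measure α} {ν : Measure β}

theorem sq_lintegral_mul_le {k f : α → ℝ≥0∞} (hk : AEMeasurable k μ) (hf : AEMeasurable f μ) :
    (∫⁻ a, k a * f a ∂μ) ^ 2 ≤ (∫⁻ a, k a ∂μ) * ∫⁻ a, k a * f a ^ 2 ∂μ := by
  have sq_sqrt (y : ℝ≥0∞) : (y ^ (1 / 2 : ℝ)) ^ 2 = y := by
    rw [← ENNReal.rpow_natCast, ← ENNReal.rpow_mul]; norm_num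
  have holder := ENNReal.lintegral_mul_le_Lp_mul_Lq μ Real.HolderConjugate.two_two
    (hk.pow_const (1 / 2 : ℝ)) ((hk.pow_const (1 / 2 : ℝ)).mul hf)
  simp only [Pi.mul_apply, ← mul_assoc, ENNReal.rpow_two, mul_pow, sq_sqrt] at holder
  simp only [← sq, sq_sqrt] at holder
  refine (pow_le_pow_left₀ zero_le holder 2).trans_eq ?_
  rw [mul_pow, sq_sqrt, sq_sqrt]

theorem lintegral_sq_lintegral_mul_le [SFinite μ] [SFinite ν] {k : α → ℝ≥0∞} {g : α → β → ℝ≥0∞}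
    {B : ℝ≥0∞} (hk : Measurable k) (hg : Measurable (Function.uncurry g))
    (hB : ∀ᵐ a ∂μ, ∫⁻ b, g a b ^ 2 ∂ν ≤ B) :
    ∫⁻ b, (∫⁻ a, k a * g a b ∂μ) ^ 2 ∂ν ≤ (∫⁻ a, k a ∂μ) ^ 2 * B := by
  have hkg : Measurable (Function.uncurry fun a b => k a * g a b ^ 2) :=
    (hk.comp measurable_fst).mul (hg.pow_const 2)
  calc ∫⁻ b, (∫⁻ a, k a * g a b ∂μ) ^ 2 ∂ν
      ≤ ∫⁻ b, (∫⁻ a, k a ∂μ) * ∫⁻ a, k a * g a b ^ 2 ∂μ ∂ν :=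
        lintegral_mono fun b => sq_lintegral_mul_le hk.aemeasurable hg.of_uncurry_right.aemeasurable
    _ = (∫⁻ a, k a ∂μ) * ∫⁻ a, k a * ∫⁻ b, g a b ^ 2 ∂ν ∂μ := by
        rw [lintegral_const_mul _ (Measurable.lintegral_prod_left' (f := fun p : α × β =>
          k p.1 * g p.1 p.2 ^ 2) hkg), ← lintegral_lintegral_swap hkg.aemeasurable]
        congr 2 with a
        rw [lintegral_const_mul _ (hg.of_uncurry_left.pow_const 2)]
    _ ≤ (∫⁻ a, k a ∂μ) * ∫⁻ a, k a * B ∂μ :=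
        mul_le_mul' le_rfl (lintegral_mono_ae (hB.mono fun a ha => mul_le_mul' le_rfl ha))
    _ = (∫⁻ a, k a ∂μ) ^ 2 * B := by rw [lintegral_mul_const _ hk, sq, mul_assoc]

theorem lintegral_comp_mul_left_Ioi {c : ℝ} (hc : 0 < c) (f : ℝ → ℝ≥0∞) :
    ∫⁻ t in Ioi (0 : ℝ), f (c * t) = ENNReal.ofReal c⁻¹ * ∫⁻ t in Ioi (0 : ℝ), f t := by
  have hemb : MeasurableEmbedding fun t : ℝ => c * t :=
    (Homeomorph.mulLeft₀ c hc.ne').measurableEmbedding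
  have hpre : (fun t : ℝ => c * t) ⁻¹' Ioi 0 = Ioi 0 := by
    ext t; simp [hc]
  calc ∫⁻ t in Ioi (0 : ℝ), f (c * t)
      = ∫⁻ t in Ioi (0 : ℝ), f t ∂(Measure.map (fun t : ℝ => c * t) volume) := by
        rw [hemb.restrict_map, hemb.lintegral_map, hpre]
    _ = ENNReal.ofReal c⁻¹ * ∫⁻ t in Ioi (0 : ℝ), f t := by
        rw [Real.map_volume_mul_left hc.ne', Measure.restrict_smul, lintegral_smul_measure,
          abs_of_pos (inv_pos.2 hc), smul_eq_mul]

theorem setIntegral_Ioi_comp_add_right {E : Type*} [NormedAddCommGroup E] [NormedSpace ℝ E]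
    (f : ℝ → E) (a c : ℝ) : ∫ u in Ioi a, f (u + c) = ∫ u in Ioi (a + c), f u := by
  have h := (measurePreserving_add_right volume c).setIntegral_preimage_emb
    (measurableEmbedding_addRight c) f (Ioi (a + c))
  rwa [preimage_add_const_Ioi, add_sub_cancel_right] at h

/-- The Haar measure `dt / t` of the multiplicative group `(0, ∞)`, as a measure on `ℝ`. -/
def mulHaar : Measure ℝ :=
  (volume.restrict (Ioi 0)).withDensity fun t => ENNReal.ofReal t⁻¹

instance : SFinite mulHaar := by
  rw [mulHaar]
  infer_instance

theorem lintegral_mulHaar (f : ℝ → ℝ≥0∞) :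
    ∫⁻ t, f t ∂mulHaar = ∫⁻ t in Ioi (0 : ℝ), ENNReal.ofReal t⁻¹ * f t :=
  lintegral_withDensity_eq_lintegral_mul_non_measurable _ (by fun_prop)
    (ae_of_all _ fun _ => ENNReal.ofReal_lt_top) f

theorem lintegral_mulHaar_comp_mul_left {c : ℝ} (hc : 0 < c) (f : ℝ → ℝ≥0∞) :
    ∫⁻ t, f (c * t) ∂mulHaar = ∫⁻ t, f t ∂mulHaar := by
  calc ∫⁻ t, f (c * t) ∂mulHaar
      = ∫⁻ t in Ioi (0 : ℝ), ENNReal.ofReal c * (ENNReal.ofReal (c * t)⁻¹ * f (c * t)) := by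
        rw [lintegral_mulHaar]
        refine lintegral_congr fun t => ?_
        rw [← mul_assoc, ← ENNReal.ofReal_mul hc.le, mul_inv, mul_inv_cancel_left₀ hc.ne']
    _ = ENNReal.ofReal (c * c⁻¹) * ∫⁻ t, f t ∂mulHaar := by
        rw [lintegral_const_mul' _ _ ENNReal.ofReal_ne_top, lintegral_mulHaar,
          lintegral_comp_mul_left_Ioi hc fun t => ENNReal.ofReal t⁻¹ * f t,
          ENNReal.ofReal_mul hc.le, mul_assoc]
    _ = ∫⁻ t, f t ∂mulHaar := by rw [mul_inv_cancel₀ hc.ne', ENNReal.ofReal_one, one_mul]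

theorem ae_mulHaar_pos : ∀ᵐ t ∂mulHaar, 0 < t :=
  (withDensity_absolutelyContinuous _ _).ae_le (ae_restrict_mem measurableSet_Ioi)

theorem lintegral_mulHaar_sub_comp_mul_left {g : ℝ → ℝ} {c L R : ℝ} (hg : ContinuousOn g (Ioi 0))
    (hc : 0 < c) (hanti : ∀ t, 0 < t → g (c * t) ≤ g t) (hL : Tendsto g (𝓝[>] 0) (𝓝 L))
    (hR : Tendsto g atTop (𝓝 R)) :
    ∫⁻ t, ENNReal.ofReal (g t - g (c * t)) ∂mulHaar =
      ENNReal.ofReal (Real.log c * (L - R)) := by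
  have hcover : AECover (volume.restrict (Ioi (0 : ℝ))) (𝓝[>] (0 : ℝ) ×ˢ atTop)
      fun p : ℝ × ℝ => Ioc p.1 p.2 :=
    (aecover_Ioi_of_Ioi (tendsto_fst.mono_right nhdsWithin_le_nhds)).inter
      (aecover_Iic tendsto_snd).restrict
  have hdil : ContinuousOn (fun t => g t - g (c * t)) (Ioi 0) :=
    hg.sub (hg.comp (by fun_prop) fun t ht => mul_pos hc ht)
  have hcont : ContinuousOn (fun t => t⁻¹ • (g t - g (c * t))) (Ioi 0) :=
    (continuousOn_inv₀.mono fun t ht => ne_of_gt ht).smul hdil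
  have hfrullani := Frullani.tendsto_intervalIntegral (hg.locallyIntegrableOn measurableSet_Ioi)
    one_pos hc hL hR
  simp only [one_mul, div_one, smul_eq_mul] at hfrullani hcont
  have hprod : ∫⁻ t, ENNReal.ofReal (g t - g (c * t)) ∂mulHaar =
      ∫⁻ t in Ioi (0 : ℝ), ENNReal.ofReal (t⁻¹ * (g t - g (c * t))) := by
    rw [lintegral_mulHaar]
    exact setLIntegral_congr_fun measurableSet_Ioi fun t ht =>
      (ENNReal.ofReal_mul (inv_nonneg.2 (le_of_lt ht))).symm
  rw [hprod]
  refine hcover.lintegral_eq_of_tendsto _ (hcont.aemeasurable measurableSet_Ioi).ennreal_ofReal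
    (((ENNReal.continuous_ofReal.tendsto _).comp hfrullani).congr' ?_)
  filter_upwards [prod_mem_prod (Ioo_mem_nhdsGT one_pos) (Ioi_mem_atTop 1)]
    with ⟨ε, r⟩ ⟨⟨hε, hε1⟩, hr⟩
  have hsub : Icc ε r ⊆ Ioi 0 := fun t ht => hε.trans_le ht.1
  have hint := ((hcont.mono hsub).integrableOn_Icc (μ := volume)).mono_set Ioc_subset_Icc_self
  rw [Function.comp_apply, intervalIntegral.integral_of_le (hε1.trans hr).le,
    ofReal_integral_eq_lintegral_ofReal hint, Measure.restrict_restrict measurableSet_Ioc,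
    inter_eq_left.2 (Ioc_subset_Icc_self.trans hsub)]
  filter_upwards [ae_restrict_mem measurableSet_Ioc] with t ht
  have ht0 : 0 < t := hε.trans ht.1
  exact mul_nonneg (inv_nonneg.2 ht0.le) (sub_nonneg.2 (hanti t ht0))

theorem enorm_map_integral_le {𝕜 E F : Type*} [RCLike 𝕜] [NormedAddCommGroup E]
    [NormedSpace 𝕜 E] [NormedSpace ℝ E] [CompleteSpace E] [NormedAddCommGroup F]
    [NormedSpace 𝕜 F] (L : E →L[𝕜] F) (f : α → E) :
    ‖L (∫ a, f a ∂μ)‖ₑ ≤ ∫⁻ a, ‖L (f a)‖ₑ ∂μ := by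
  by_cases hf : Integrable f μ
  · let : NormedSpace ℝ F := NormedSpace.restrictScalars ℝ 𝕜 F
    let ι : F →L[𝕜] UniformSpace.Completion F := UniformSpace.Completion.toComplL
    have hι (y : F) : ‖ι y‖ₑ = ‖y‖ₑ := by
      rw [← ofReal_norm, ← ofReal_norm]
      exact congrArg _ (UniformSpace.Completion.norm_coe y)
    calc ‖L (∫ a, f a ∂μ)‖ₑ = ‖∫ a, (ι ∘L L) (f a) ∂μ‖ₑ := by
          rw [ContinuousLinearMap.integral_comp_comm _ hf, ContinuousLinearMap.comp_apply, hι]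
      _ ≤ ∫⁻ a, ‖L (f a)‖ₑ ∂μ := by
          simpa only [ContinuousLinearMap.comp_apply, hι] using
            enorm_integral_le_lintegral_enorm fun a => (ι ∘L L) (f a)
  · rw [integral_undef hf, map_zero, enorm_zero]
    exact zero_le

end Lintegral

section Resolvent

variable {X : Type*} [NormedAddCommGroup X] [InnerProductSpace ℂ X] {T : ℝ → X →L[ℂ] X}
  {A : X →ₗ.[ℂ] X}

/-- The family `T` extended to negative times by `T 0`, so that the orbits of a strongly
continuous semigroup are continuous on all of `ℝ`. -/
def flow (T : ℝ → X →L[ℂ] X) (t : ℝ) : X →L[ℂ] X := T (max t 0)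

theorem flow_of_nonneg {t : ℝ} (ht : 0 ≤ t) : flow T t = T t := by
  rw [flow, max_eq_left ht]

namespace IsContractionSemigroup

theorem norm_flow_apply_le (hT : IsContractionSemigroup T) (t : ℝ) (x : X) :
    ‖flow T t x‖ ≤ ‖x‖ :=
  (T _).le_of_opNorm_le (hT.norm_le_one _ (le_max_right t 0)) x |>.trans_eq (one_mul _)

theorem flow_zero (hT : IsContractionSemigroup T) (x : X) : flow T 0 x = x := by
  rw [flow_of_nonneg le_rfl, hT.map_zero, ContinuousLinearMap.id_apply]

theorem flow_add (hT : IsContractionSemigroup T) {s t : ℝ} (hs : 0 ≤ s) (ht : 0 ≤ t) (x : X) :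
    flow T (s + t) x = flow T s (flow T t x) := by
  rw [flow_of_nonneg hs, flow_of_nonneg ht, flow_of_nonneg (add_nonneg hs ht),
    hT.map_add s t hs ht, ContinuousLinearMap.comp_apply]

theorem flow_comm (hT : IsContractionSemigroup T) (s t : ℝ) (x : X) :
    flow T s (flow T t x) = flow T t (flow T s x) := by
  simp only [flow, ← ContinuousLinearMap.comp_apply,
    ← hT.map_add _ _ (le_max_right _ _) (le_max_right _ _)]
  rw [add_comm]

theorem continuous_flow (hT : IsContractionSemigroup T) (x : X) :
    Continuous fun t : ℝ => flow T t x :=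
  (hT.continuousOn x).comp_continuous (by fun_prop) fun t => le_max_right t 0

theorem integrable_smul_flow (hT : IsContractionSemigroup T) {μ : Measure ℝ} {k f : ℝ → ℝ}
    (hk : Integrable k μ) (hf : Continuous f) (x : X) :
    Integrable (fun u => k u • flow T (f u) x) μ := by
  refine (hk.norm.mul_const ‖x‖).mono'
    (hk.aestronglyMeasurable.smul ((hT.continuous_flow x).comp hf).aestronglyMeasurable)
    (ae_of_all _ fun u => ?_)
  rw [norm_smul]
  gcongr
  exact hT.norm_flow_apply_le _ x

theorem integrableOn_exp_smul_flow (hT : IsContractionSemigroup T) (t : ℝ) (x : X) :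
    IntegrableOn (fun u => Real.exp (-u) • flow T (t * u) x) (Ioi 0) :=
  hT.integrable_smul_flow (integrableOn_exp_neg_Ioi 0) (continuous_const_mul t) x

theorem norm_integral_exp_smul_flow_le (hT : IsContractionSemigroup T) (t : ℝ) (x : X) :
    ‖∫ u in Ioi (0 : ℝ), Real.exp (-u) • flow T (t * u) x‖ ≤ ‖x‖ := by
  refine (norm_integral_le_of_norm_le ((integrableOn_exp_neg_Ioi 0).mul_const ‖x‖)
    (ae_of_all _ fun u => ?_)).trans_eq ?_
  · rw [norm_smul, Real.norm_of_nonneg (Real.exp_pos _).le]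
    gcongr
    exact hT.norm_flow_apply_le _ x
  · rw [integral_mul_const, integral_exp_neg_Ioi_zero, one_mul]

/-- For `t > 0` this is `(1 + t A)⁻¹`, where `-A` is the generator of `T`, given by the Laplace
transform `x ↦ ∫_0^∞ e^{-u} T(t u) x du`. -/
def res (hT : IsContractionSemigroup T) (t : ℝ) : X →L[ℂ] X :=
  LinearMap.mkContinuous
    { toFun := fun x => ∫ u in Ioi (0 : ℝ), Real.exp (-u) • flow T (t * u) x
      map_add' := fun x y => by
        rw [← integral_add (hT.integrableOn_exp_smul_flow t x) (hT.integrableOn_exp_smul_flow t y)]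
        simp only [_root_.map_add, smul_add]
      map_smul' := fun c x => by
        rw [RingHom.id_apply, ← integral_smul c]
        simp only [map_smul, smul_comm c] }
    1 fun x => (hT.norm_integral_exp_smul_flow_le t x).trans_eq (one_mul _).symm

variable (hT : IsContractionSemigroup T)

theorem res_apply (t : ℝ) (x : X) :
    hT.res t x = ∫ u in Ioi (0 : ℝ), Real.exp (-u) • flow T (t * u) x := rfl

theorem norm_res_apply_le (t : ℝ) (x : X) : ‖hT.res t x‖ ≤ ‖x‖ :=
  hT.norm_integral_exp_smul_flow_le t x

theorem continuous_res (x : X) : Continuous fun t : ℝ => hT.res t x := by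
  refine continuous_of_dominated (bound := fun u => Real.exp (-u) * ‖x‖)
    (fun t => (hT.integrableOn_exp_smul_flow t x).aestronglyMeasurable)
    (fun t => ae_of_all _ fun u => ?_) ((integrableOn_exp_neg_Ioi 0).mul_const ‖x‖)
    (ae_of_all _ fun u => ?_)
  · rw [norm_smul, Real.norm_of_nonneg (Real.exp_pos _).le]
    gcongr
    exact hT.norm_flow_apply_le _ x
  · exact ((hT.continuous_flow x).comp (continuous_mul_const u)).const_smul _

variable [CompleteSpace X]

theorem res_zero (x : X) : hT.res 0 x = x := by
  simp only [res_apply, zero_mul, hT.flow_zero]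
  rw [integral_smul_const, integral_exp_neg_Ioi_zero, one_smul]

theorem map_res_of_comm {S : X →L[ℂ] X} (hS : ∀ s x, S (flow T s x) = flow T s (S x)) (t : ℝ)
    (x : X) : S (hT.res t x) = hT.res t (S x) := by
  rw [res_apply, res_apply,
    ← ContinuousLinearMap.integral_comp_comm _ (hT.integrableOn_exp_smul_flow t x)]
  simp only [ContinuousLinearMap.map_smul_of_tower, hS]

theorem flow_res (s t : ℝ) (x : X) : flow T s (hT.res t x) = hT.res t (flow T s x) :=
  hT.map_res_of_comm (hT.flow_comm s) t x

theorem res_comm (s t : ℝ) (x : X) : hT.res s (hT.res t x) = hT.res t (hT.res s x) :=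
  hT.map_res_of_comm (fun r y => (hT.flow_res r s y).symm) t x

theorem flow_res_eq {t h : ℝ} (ht : 0 < t) (hh : 0 ≤ h) (x : X) :
    flow T h (hT.res t x) = Real.exp (h / t) •
      (hT.res t x - ∫ u in (0 : ℝ)..(h / t), Real.exp (-u) • flow T (t * u) x) := by
  have hint := hT.integrableOn_exp_smul_flow t x
  have htail : hT.res t x - ∫ u in (0 : ℝ)..(h / t), Real.exp (-u) • flow T (t * u) x
      = ∫ u in Ioi (h / t), Real.exp (-u) • flow T (t * u) x := by
    rw [res_apply, sub_eq_iff_eq_add', intervalIntegral.integral_interval_add_Ioi hint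
      (hint.mono_set (Ioi_subset_Ioi (div_nonneg hh ht.le)))]
  have hshift :=
    setIntegral_Ioi_comp_add_right (fun u => Real.exp (-u) • flow T (t * u) x) 0 (h / t)
  rw [zero_add] at hshift
  rw [htail, ← hshift, ← integral_smul, res_apply, ← ContinuousLinearMap.integral_comp_comm _ hint]
  refine setIntegral_congr_fun measurableSet_Ioi fun u hu => ?_
  have htu : 0 ≤ t * u := mul_nonneg ht.le (le_of_lt hu)
  have hexp : Real.exp (h / t) * Real.exp (-(u + h / t)) = Real.exp (-u) := by
    rw [← Real.exp_add]
    ring_nf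
  rw [ContinuousLinearMap.map_smul_of_tower, ← hT.flow_add hh htu, smul_smul, hexp, mul_add,
    mul_div_cancel₀ _ ht.ne', add_comm]

theorem tendsto_slope_res {t : ℝ} (ht : 0 < t) (x : X) :
    Tendsto (fun h : ℝ => h⁻¹ • (T h (hT.res t x) - hT.res t x)) (𝓝[>] 0)
      (𝓝 (t⁻¹ • (hT.res t x - x))) := by
  have hf : Continuous fun u : ℝ => Real.exp (-u) • flow T (t * u) x :=
    (by fun_prop : Continuous fun u : ℝ => Real.exp (-u)).smul
      ((hT.continuous_flow x).comp (continuous_const_mul t))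
  have hprimitive : HasDerivAt
      (fun q : ℝ => ∫ u in (0 : ℝ)..q, Real.exp (-u) • flow T (t * u) x) x 0 := by
    simpa [hT.flow_zero] using intervalIntegral.integral_hasDerivAt_right
      (hf.intervalIntegrable 0 0) hf.stronglyMeasurable.stronglyMeasurableAtFilter hf.continuousAt
  have hdiv : HasDerivAt (fun h : ℝ => h / t) t⁻¹ 0 := by
    simpa using (hasDerivAt_id (0 : ℝ)).div_const t
  have hderiv := HasDerivAt.scomp_of_eq (0 : ℝ)
    ((Real.hasDerivAt_exp 0).fun_smul (hprimitive.const_sub (hT.res t x))) hdiv (by simp)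
  have hslope := (hasDerivAt_iff_tendsto_slope_zero.1 hderiv).mono_left
    (nhdsWithin_mono (0 : ℝ) fun h (hh : 0 < h) => hh.ne')
  simp only [Real.exp_zero, one_smul, intervalIntegral.integral_same, sub_zero,
    neg_add_eq_sub, zero_add, Function.comp_apply, zero_div] at hslope
  refine hslope.congr' ?_
  filter_upwards [self_mem_nhdsWithin] with h hh
  rw [← hT.flow_res_eq ht (le_of_lt hh), flow_of_nonneg (le_of_lt hh)]

theorem tendsto_slope_integral_flow (hT : IsContractionSemigroup T) {h : ℝ} (hh : 0 ≤ h)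
    (x : X) :
    Tendsto (fun δ : ℝ =>
        δ⁻¹ • (T δ (∫ u in (0 : ℝ)..h, flow T u x) - ∫ u in (0 : ℝ)..h, flow T u x))
      (𝓝[>] 0) (𝓝 (flow T h x - x)) := by
  have hf := hT.continuous_flow x
  have hint (a b : ℝ) : IntervalIntegrable (fun u => flow T u x) volume a b :=
    hf.intervalIntegrable a b
  have hprimitive (b : ℝ) :
      HasDerivAt (fun q : ℝ => ∫ u in (0 : ℝ)..q, flow T u x) (flow T b x) b :=
    intervalIntegral.integral_hasDerivAt_right (hint 0 b)
      hf.stronglyMeasurable.stronglyMeasurableAtFilter hf.continuousAt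
  have hderiv : HasDerivAt (fun δ : ℝ => (∫ u in (0 : ℝ)..(h + δ), flow T u x) -
      ∫ u in (0 : ℝ)..δ, flow T u x) (flow T h x - x) 0 := by
    have hshift := (hprimitive (h + 0)).comp_const_add h 0
    simpa only [add_zero, hT.flow_zero] using hshift.fun_sub (hprimitive 0)
  have hslope := (hasDerivAt_iff_tendsto_slope_zero.1 hderiv).mono_left
    (nhdsWithin_mono (0 : ℝ) fun δ (hδ : 0 < δ) => hδ.ne')
  simp only [zero_add, add_zero, intervalIntegral.integral_same, sub_zero] at hslope
  refine hslope.congr' ?_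
  filter_upwards [self_mem_nhdsWithin] with δ hδ
  have hδ' : (0 : ℝ) ≤ δ := le_of_lt hδ
  have hT_integral : T δ (∫ u in (0 : ℝ)..h, flow T u x) = ∫ u in δ..(h + δ), flow T u x := by
    have hshift := intervalIntegral.integral_comp_add_right (a := 0) (b := h)
      (fun u => flow T u x) δ
    rw [zero_add] at hshift
    rw [← ContinuousLinearMap.intervalIntegral_comp_comm _ (hint 0 h), ← hshift]
    refine intervalIntegral.integral_congr fun u hu => ?_
    rw [uIcc_of_le hh] at hu
    rw [add_comm u, hT.flow_add hδ' hu.1, flow_of_nonneg hδ']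
  rw [hT_integral, intervalIntegral.integral_interval_sub_left (hint 0 _) (hint 0 _)]

end IsContractionSemigroup

end Resolvent

section Generator

variable {X : Type*} [NormedAddCommGroup X] [InnerProductSpace ℂ X] {T : ℝ → X →L[ℂ] X}
  {A : X →ₗ.[ℂ] X}

theorem re_inner_real_smul_right (r : ℝ) (x y : X) :
    (inner ℂ x (r • y)).re = r * (inner ℂ x y).re := by
  rw [← Complex.coe_smul, inner_smul_right, Complex.re_ofReal_mul]

theorem re_inner_self (x : X) : (inner ℂ x x).re = ‖x‖ ^ 2 :=
  inner_self_eq_norm_sq (𝕜 := ℂ) x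

namespace IsGenerator

theorem mem_graph_iff (hA : IsGenerator T (-A)) {x y : X} :
    (x, y) ∈ A.graph ↔ Tendsto (fun t : ℝ => t⁻¹ • (T t x - x)) (𝓝[>] 0) (𝓝 (-y)) := by
  rw [← hA]
  simp only [LinearPMap.mem_graph_iff, LinearPMap.neg_apply, neg_inj]
  rfl

theorem re_inner_nonneg (hT : IsContractionSemigroup T) (hA : IsGenerator T (-A)) {x y : X}
    (hxy : (x, y) ∈ A.graph) : 0 ≤ (inner ℂ x y).re := by
  have hlim : Tendsto (fun t : ℝ => (inner ℂ x (t⁻¹ • (T t x - x))).re) (𝓝[>] 0)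
      (𝓝 (inner ℂ x (-y)).re) :=
    (Complex.continuous_re.tendsto _).comp (tendsto_const_nhds.inner (hA.mem_graph_iff.1 hxy))
  rw [← neg_nonpos, ← Complex.neg_re, ← inner_neg_right]
  refine le_of_tendsto hlim ?_
  filter_upwards [self_mem_nhdsWithin] with t ht
  have ht' : (0 : ℝ) < t := ht
  have hcontr : (inner ℂ x (T t x)).re ≤ ‖x‖ ^ 2 :=
    calc (inner ℂ x (T t x)).re ≤ ‖x‖ * ‖T t x‖ := re_inner_le_norm (𝕜 := ℂ) x (T t x)
      _ ≤ ‖x‖ * ‖x‖ := by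
        rw [← flow_of_nonneg (T := T) ht'.le]
        gcongr
        exact hT.norm_flow_apply_le t x
      _ = ‖x‖ ^ 2 := (sq _).symm
  rw [re_inner_real_smul_right, inner_sub_right, Complex.sub_re, re_inner_self]
  exact mul_nonpos_of_nonneg_of_nonpos (inv_nonneg.2 ht'.le) (sub_nonpos.2 hcontr)

theorem norm_le_norm_add_smul (hT : IsContractionSemigroup T) (hA : IsGenerator T (-A)) {t : ℝ}
    (ht : 0 ≤ t) {x y : X} (hxy : (x, y) ∈ A.graph) : ‖x‖ ≤ ‖x + t • y‖ := by
  have hinner : ‖x‖ ^ 2 ≤ ‖x‖ * ‖x + t • y‖ :=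
    calc ‖x‖ ^ 2 ≤ (inner ℂ x (x + t • y)).re := by
          rw [inner_add_right, Complex.add_re, re_inner_real_smul_right, re_inner_self]
          exact le_add_of_nonneg_right (mul_nonneg ht (hA.re_inner_nonneg hT hxy))
      _ ≤ ‖x‖ * ‖x + t • y‖ := re_inner_le_norm (𝕜 := ℂ) x (x + t • y)
  rcases (norm_nonneg x).eq_or_lt with hx | hx
  · exact hx ▸ norm_nonneg _
  · exact le_of_mul_le_mul_left (by rwa [← sq]) hx

variable [CompleteSpace X] (hT : IsContractionSemigroup T)

theorem res_mem_graph (hA : IsGenerator T (-A)) {t : ℝ} (ht : 0 < t) (x : X) :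
    (hT.res t x, t⁻¹ • (x - hT.res t x)) ∈ A.graph := by
  rw [hA.mem_graph_iff, ← smul_neg, neg_sub]
  exact hT.tendsto_slope_res ht x

theorem res_mem_domain (hA : IsGenerator T (-A)) {t : ℝ} (ht : 0 < t) (x : X) :
    hT.res t x ∈ A.domain :=
  LinearPMap.mem_domain_of_mem_graph (hA.res_mem_graph hT ht x)

theorem eq_res_add_smul (hA : IsGenerator T (-A)) {t : ℝ} (ht : 0 < t) {x y : X}
    (hxy : (x, y) ∈ A.graph) : x = hT.res t (x + t • y) := by
  have hdiff := A.graph.sub_mem hxy (hA.res_mem_graph hT ht (x + t • y))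
  have hle := hA.norm_le_norm_add_smul hT ht.le hdiff
  have hzero : x - hT.res t (x + t • y) +
      t • (y - t⁻¹ • (x + t • y - hT.res t (x + t • y))) = 0 := by
    rw [smul_sub, smul_inv_smul₀ ht.ne']
    abel
  rw [hzero, norm_zero] at hle
  exact sub_eq_zero.1 (norm_le_zero_iff.1 hle)

theorem sub_smul_res_res (hA : IsGenerator T (-A)) {s t : ℝ} (hs : 0 < s) (ht : 0 < t) (x : X) :
    (s - t) • hT.res s (hT.res t x) = s • hT.res s x - t • hT.res t x := by
  have hgraph (r : ℝ) (hr : 0 < r) : (r • hT.res r x, x - hT.res r x) ∈ A.graph := by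
    have h := A.graph.smul_mem (r : ℂ) (hA.res_mem_graph hT hr x)
    rwa [Prod.smul_mk, Complex.coe_smul, Complex.coe_smul, smul_inv_smul₀ hr.ne'] at h
  have h := hA.eq_res_add_smul hT hs (A.graph.sub_mem (hgraph s hs) (hgraph t ht))
  have harg : s • hT.res s x - t • hT.res t x + s • (x - hT.res s x - (x - hT.res t x)) =
      (s - t) • hT.res t x := by
    module
  rw [harg, ContinuousLinearMap.map_smul_of_tower] at h
  exact h.symm

theorem resolventAt_eq (hA : IsGenerator T (-A)) {s : ℝ} (hs : 0 < s) (x : X) :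
    (resolventAt A s x : X) = s⁻¹ • hT.res s⁻¹ x := by
  have hsolve : ∃ y : A.domain, s • (y : X) + A y = x := by
    obtain ⟨y, hy, hAy⟩ :=
      (LinearPMap.mem_graph_iff _).1 (hA.res_mem_graph hT (inv_pos.2 hs) (s⁻¹ • x))
    refine ⟨y, ?_⟩
    rw [hy, hAy, inv_inv, smul_sub, smul_inv_smul₀ hs.ne', add_sub_cancel]
  have hres : s • (resolventAt A s x : X) + A (resolventAt A s x) = x :=
    Function.invFun_eq (f := fun y : A.domain => s • (y : X) + A y) hsolve
  have harg : (resolventAt A s x : X) + s⁻¹ • A (resolventAt A s x) = s⁻¹ • x := by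
    conv_rhs => rw [← hres]
    rw [smul_add, inv_smul_smul₀ hs.ne']
  rw [hA.eq_res_add_smul hT (inv_pos.2 hs) (A.mem_graph _), harg,
    ContinuousLinearMap.map_smul_of_tower]

theorem norm_res_apply_graph_le (hA : IsGenerator T (-A)) {t : ℝ} (ht : 0 < t) {x y : X}
    (hxy : (x, y) ∈ A.graph) : ‖hT.res t y‖ ≤ t⁻¹ * (2 * ‖x‖) := by
  have hsmul : t • hT.res t y = x - hT.res t x := by
    have h := hA.eq_res_add_smul hT ht hxy
    rw [map_add, ContinuousLinearMap.map_smul_of_tower] at h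
    exact eq_sub_of_add_eq' h.symm
  rw [← inv_smul_smul₀ ht.ne' (hT.res t y), hsmul, norm_smul, Real.norm_of_nonneg (inv_pos.2 ht).le]
  gcongr
  linarith [norm_sub_le x (hT.res t x), hT.norm_res_apply_le t x]

theorem tendsto_res_atTop (hA : IsGenerator T (-A)) (hdense : Dense (opRange A : Set X)) (x : X) :
    Tendsto (fun t => hT.res t x) atTop (𝓝 0) := by
  rw [Metric.tendsto_nhds]
  intro ε hε
  obtain ⟨_, hz, y, rfl⟩ := Metric.dense_iff.1 hdense x (ε / 2) (half_pos hε)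
  have hlim : Tendsto (fun t : ℝ => t⁻¹ * (2 * ‖(y : X)‖)) atTop (𝓝 0) := by
    simpa using tendsto_inv_atTop_zero.mul_const (2 * ‖(y : X)‖)
  filter_upwards [hlim.eventually (gt_mem_nhds (half_pos hε)), eventually_gt_atTop 0]
    with t ht ht0
  rw [dist_zero_right]
  calc ‖hT.res t x‖ = ‖hT.res t (x - A y) + hT.res t (A y)‖ := by rw [← map_add, sub_add_cancel]
    _ ≤ ‖x - A y‖ + t⁻¹ * (2 * ‖(y : X)‖) :=
      norm_add_le_of_le (hT.norm_res_apply_le _ _)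
        (hA.norm_res_apply_graph_le hT ht0 (A.mem_graph y))
    _ < ε / 2 + ε / 2 := by
      gcongr
      rw [← dist_eq_norm, dist_comm]
      exact hz
    _ = ε := add_halves ε

theorem flow_sub_self_mem_opRange (hT : IsContractionSemigroup T) (hA : IsGenerator T (-A)) {t : ℝ}
    (ht : 0 ≤ t) (x : X) :
    flow T t x - x ∈ opRange A := by
  have hgraph : (∫ u in (0 : ℝ)..t, flow T u x, x - flow T t x) ∈ A.graph := by
    rw [hA.mem_graph_iff, neg_sub]
    exact hT.tendsto_slope_integral_flow ht x
  obtain ⟨y, -, hy⟩ := (LinearPMap.mem_graph_iff _).1 hgraph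
  exact ⟨-y, by rw [map_neg, ← neg_sub x]; exact congrArg _ hy⟩

end IsGenerator

end Generator

section Adjoint

variable {E : Type*} [NormedAddCommGroup E] [InnerProductSpace ℂ E]

theorem mul_norm_sq_le_re_inner_iff {c : ℝ} (hc : 0 < c) (x y : E) :
    c * ‖y‖ ^ 2 ≤ (inner ℂ x y).re ↔ ‖(2 * c) • y - x‖ ≤ ‖x‖ := by
  have hexpand : ‖(2 * c) • y - x‖ ^ 2 =
      ‖x‖ ^ 2 - 4 * c * ((inner ℂ x y).re - c * ‖y‖ ^ 2) := by
    rw [norm_sub_rev, norm_sub_sq (𝕜 := ℂ), RCLike.re_eq_complex_re, re_inner_real_smul_right,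
      norm_smul, Real.norm_of_nonneg (by positivity)]
    ring
  rw [← sq_le_sq₀ (norm_nonneg _) (norm_nonneg _), hexpand, sub_le_self_iff,
    mul_nonneg_iff_of_pos_left (by positivity), sub_nonneg]

theorem mul_norm_sq_adjoint_apply_le [CompleteSpace E] {S : E →L[ℂ] E} {c : ℝ} (hc : 0 < c)
    (hS : ∀ x, c * ‖S x‖ ^ 2 ≤ (inner ℂ x (S x)).re) (x : E) :
    c * ‖S.adjoint x‖ ^ 2 ≤ (inner ℂ x (S x)).re := by
  let U : E →L[ℂ] E := ((2 * c : ℝ) : ℂ) • S - 1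
  have hU : ‖U‖ ≤ 1 := U.opNorm_le_bound zero_le_one fun y => by
    rw [one_mul]
    exact (mul_norm_sq_le_re_inner_iff hc y (S y)).1 (hS y)
  have hadj : U.adjoint x = (2 * c) • S.adjoint x - x := by
    rw [map_sub, map_smulₛₗ, Complex.conj_ofReal, ContinuousLinearMap.adjoint_one, sub_apply,
      smul_apply, Complex.coe_smul, one_apply_eq_self]
  have hle : ‖(2 * c) • S.adjoint x - x‖ ≤ ‖x‖ := by
    rw [← hadj]
    exact U.adjoint.le_of_opNorm_le ((ContinuousLinearMap.adjoint.norm_map U).trans_le hU) x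
      |>.trans_eq (one_mul _)
  have h := (mul_norm_sq_le_re_inner_iff hc x _).2 hle
  rwa [ContinuousLinearMap.adjoint_inner_right, ← inner_conj_symm, Complex.conj_re] at h

end Adjoint

section SquareFunction

variable {X : Type*} [NormedAddCommGroup X] [InnerProductSpace ℂ X] {T : ℝ → X →L[ℂ] X}
  {A : X →ₗ.[ℂ] X}

/-- The dyadic difference `T(t) - T(2t)` of the semigroup, the operator under the integral in the
semigroup square function. -/
def flowDiff (T : ℝ → X →L[ℂ] X) (t : ℝ) : X →L[ℂ] X := flow T t - flow T (2 * t)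

theorem flowDiff_apply (t : ℝ) (x : X) : flowDiff T t x = flow T t x - flow T (2 * t) x := rfl

namespace IsContractionSemigroup

/-- The dyadic difference `(1 + t A)⁻¹ - (1 + 2 t A)⁻¹`, the operator under the integral in the
resolvent square function. -/
def resDiff (hT : IsContractionSemigroup T) (t : ℝ) : X →L[ℂ] X := hT.res t - hT.res (2 * t)

theorem resDiff_apply (hT : IsContractionSemigroup T) (t : ℝ) (x : X) :
    hT.resDiff t x = hT.res t x - hT.res (2 * t) x := rfl

theorem continuous_flowDiff (hT : IsContractionSemigroup T) (x : X) :
    Continuous fun t => flowDiff T t x :=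
  (hT.continuous_flow x).sub ((hT.continuous_flow x).comp (continuous_const_mul 2))

theorem continuous_resDiff (hT : IsContractionSemigroup T) (x : X) :
    Continuous fun t => hT.resDiff t x :=
  (hT.continuous_res x).sub ((hT.continuous_res x).comp (continuous_const_mul 2))

theorem resDiff_eq_integral (hT : IsContractionSemigroup T) (t : ℝ) (x : X) :
    hT.resDiff t x = ∫ u in Ioi (0 : ℝ), Real.exp (-u) • flowDiff T (t * u) x := by
  rw [resDiff_apply, res_apply, res_apply, ← integral_sub (hT.integrableOn_exp_smul_flow _ x)
    (hT.integrableOn_exp_smul_flow _ x)]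
  simp only [flowDiff_apply, smul_sub, mul_assoc]

theorem lintegral_enorm_sq_resDiff_le (hT : IsContractionSemigroup T) (x : X) :
    ∫⁻ t, ‖hT.resDiff t x‖ₑ ^ 2 ∂mulHaar ≤ ∫⁻ t, ‖flowDiff T t x‖ₑ ^ 2 ∂mulHaar := by
  have hexp : ∫⁻ u in Ioi (0 : ℝ), ENNReal.ofReal (Real.exp (-u)) = 1 := by
    rw [← ofReal_integral_eq_lintegral_ofReal (integrableOn_exp_neg_Ioi 0)
      (ae_of_all _ fun u => (Real.exp_pos _).le), integral_exp_neg_Ioi_zero, ENNReal.ofReal_one]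
  have hpoint (t : ℝ) : ‖hT.resDiff t x‖ₑ ≤
      ∫⁻ u in Ioi (0 : ℝ), ENNReal.ofReal (Real.exp (-u)) * ‖flowDiff T (t * u) x‖ₑ := by
    rw [resDiff_eq_integral]
    refine (enorm_integral_le_lintegral_enorm _).trans_eq (lintegral_congr fun u => ?_)
    rw [enorm_smul, Real.enorm_eq_ofReal (Real.exp_pos _).le]
  have hmeas : Measurable (Function.uncurry fun u t : ℝ => ‖flowDiff T (t * u) x‖ₑ) :=
    ((hT.continuous_flowDiff x).comp (by fun_prop :
      Continuous fun p : ℝ × ℝ => p.2 * p.1)).enorm.measurable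
  have hdilate : ∀ᵐ u ∂volume.restrict (Ioi (0 : ℝ)),
      ∫⁻ t, ‖flowDiff T (t * u) x‖ₑ ^ 2 ∂mulHaar ≤ ∫⁻ t, ‖flowDiff T t x‖ₑ ^ 2 ∂mulHaar := by
    filter_upwards [ae_restrict_mem measurableSet_Ioi] with u hu
    simp only [mul_comm _ u]
    exact (lintegral_mulHaar_comp_mul_left hu fun t => ‖flowDiff T t x‖ₑ ^ 2).le
  refine (lintegral_mono fun t => pow_le_pow_left₀ zero_le (hpoint t) 2).trans
    ((lintegral_sq_lintegral_mul_le (by fun_prop) hmeas hdilate).trans_eq ?_)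
  rw [hexp, one_pow, one_mul]

end IsContractionSemigroup

namespace IsGenerator

variable [CompleteSpace X] (hT : IsContractionSemigroup T)

theorem re_inner_res_nonneg (hA : IsGenerator T (-A)) {t : ℝ} (ht : 0 < t) (x : X) :
    0 ≤ (inner ℂ (hT.res t x) (x - hT.res t x)).re := by
  have h := hA.re_inner_nonneg hT (hA.res_mem_graph hT ht x)
  rw [re_inner_real_smul_right] at h
  exact nonneg_of_mul_nonneg_right h (inv_pos.2 ht)

theorem res_res_two_mul (hA : IsGenerator T (-A)) {t : ℝ} (ht : 0 < t) (x : X) :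
    hT.res t (hT.res (2 * t) x) = (2 : ℝ) • hT.res (2 * t) x - hT.res t x := by
  have h := hA.sub_smul_res_res hT ht (mul_pos two_pos ht) x
  refine smul_right_injective X ht.ne' ?_
  linear_combination (norm := module) (-1 : ℝ) • h

theorem three_mul_norm_sq_resDiff_le (hA : IsGenerator T (-A)) {t : ℝ} (ht : 0 < t) (x : X) :
    3 * ‖hT.resDiff t x‖ ^ 2 ≤ (inner ℂ x (hT.resDiff t x)).re := by
  set D := hT.resDiff t x with hD
  set y := hT.res (2 * t) x with hy
  have hlow : 0 ≤ (inner ℂ (y - D) D).re := by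
    have h := hA.re_inner_res_nonneg hT ht y
    have hJ : hT.res t y = y - D := by
      rw [hy, hA.res_res_two_mul hT ht, hD, hT.resDiff_apply]
      module
    rwa [hJ, sub_sub_cancel] at h
  have hhigh : 0 ≤ (inner ℂ ((2 : ℝ) • D) (x - y - (2 : ℝ) • D)).re := by
    have h := hA.re_inner_res_nonneg hT ht (x - y)
    have hJ : hT.res t (x - y) = (2 : ℝ) • D := by
      rw [map_sub, hy, hA.res_res_two_mul hT ht, hD, hT.resDiff_apply]
      module
    rwa [hJ] at h
  have hsymm (u v : X) : (inner ℂ u v).re = (inner ℂ v u).re := inner_re_symm (𝕜 := ℂ) u v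
  rw [hsymm, re_inner_real_smul_right] at hhigh
  simp only [inner_sub_left, Complex.sub_re, hsymm _ D, re_inner_real_smul_right,
    re_inner_self] at hlow hhigh
  rw [hsymm]
  linarith

theorem re_inner_resDiff_nonneg (hA : IsGenerator T (-A)) {t : ℝ} (ht : 0 < t) (x : X) :
    0 ≤ (inner ℂ x (hT.resDiff t x)).re :=
  (by positivity : 0 ≤ 3 * ‖hT.resDiff t x‖ ^ 2).trans (hA.three_mul_norm_sq_resDiff_le hT ht x)

theorem resDiff_resDiff_four_mul (hA : IsGenerator T (-A)) {t : ℝ} (ht : 0 < t) (x : X) :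
    (21 : ℝ) • hT.resDiff t (hT.resDiff (4 * t) x) = (10 : ℝ) • hT.resDiff (2 * t) x -
      (4 : ℝ) • (hT.resDiff t x + hT.resDiff (4 * t) x) := by
  have h (a b : ℝ) (ha : 0 < a) (hb : 0 < b) :
      (a - b) • hT.res (a * t) (hT.res (b * t) x) =
        a • hT.res (a * t) x - b • hT.res (b * t) x := by
    have h := hA.sub_smul_res_res hT (mul_pos ha ht) (mul_pos hb ht) x
    refine smul_right_injective X ht.ne' ?_
    linear_combination (norm := module) (1 : ℝ) • h
  have h14 := h 1 4 one_pos four_pos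
  have h18 := h 1 8 one_pos (by norm_num)
  have h24 := h 2 4 two_pos four_pos
  have h28 := h 2 8 two_pos (by norm_num)
  have h2 : 2 * (2 * t) = 4 * t := by ring
  have h4 : 2 * (4 * t) = 8 * t := by ring
  rw [one_mul] at h14 h18
  simp only [IsContractionSemigroup.resDiff_apply, map_sub, h2, h4]
  linear_combination (norm := module) (-7 : ℝ) • h14 + (3 : ℝ) • h18 + (21 / 2 : ℝ) • h24 -
    (7 / 2 : ℝ) • h28

theorem ten_mul_re_inner_resDiff_le (hA : IsGenerator T (-A)) {t : ℝ} (ht : 0 < t) (x : X) :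
    10 * (inner ℂ x (hT.resDiff (2 * t) x)).re ≤ 5 * (inner ℂ x (hT.resDiff t x)).re +
      4 * (inner ℂ x (hT.resDiff (4 * t) x)).re + 37 * ‖hT.resDiff (4 * t) x‖ ^ 2 := by
  have hident := congrArg (fun y => (inner ℂ x y).re) (hA.resDiff_resDiff_four_mul hT ht x)
  simp only [inner_sub_right, inner_add_right, Complex.sub_re, Complex.add_re,
    re_inner_real_smul_right] at hident
  have hadj := mul_norm_sq_adjoint_apply_le three_pos (hA.three_mul_norm_sq_resDiff_le hT ht) x
  have hcs : (inner ℂ x (hT.resDiff t (hT.resDiff (4 * t) x))).re ≤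
      ‖(hT.resDiff t).adjoint x‖ * ‖hT.resDiff (4 * t) x‖ := by
    rw [← ContinuousLinearMap.adjoint_inner_left]
    exact re_inner_le_norm (𝕜 := ℂ) _ _
  have hamgm : 21 * (‖(hT.resDiff t).adjoint x‖ * ‖hT.resDiff (4 * t) x‖) ≤
      3 * ‖(hT.resDiff t).adjoint x‖ ^ 2 + 37 * ‖hT.resDiff (4 * t) x‖ ^ 2 := by
    nlinarith [sq_nonneg (2 * ‖(hT.resDiff t).adjoint x‖ - 7 * ‖hT.resDiff (4 * t) x‖)]
  linarith

theorem lintegral_re_inner_resDiff (hA : IsGenerator T (-A)) (hdense : Dense (opRange A : Set X))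
    (x : X) :
    ∫⁻ t, ENNReal.ofReal (inner ℂ x (hT.resDiff t x)).re ∂mulHaar =
      ENNReal.ofReal (Real.log 2 * ‖x‖ ^ 2) := by
  have hcont : Continuous fun t => (inner ℂ x (hT.res t x)).re :=
    Complex.continuous_re.comp (continuous_const.inner (hT.continuous_res x))
  have hzero : Tendsto (fun t => (inner ℂ x (hT.res t x)).re) (𝓝[>] 0) (𝓝 (‖x‖ ^ 2)) := by
    have h := (hcont.tendsto 0).mono_left (nhdsWithin_le_nhds (s := Ioi 0))
    rwa [hT.res_zero, re_inner_self] at h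
  have htop : Tendsto (fun t => (inner ℂ x (hT.res t x)).re) atTop (𝓝 0) := by
    have h := (Complex.continuous_re.tendsto _).comp
      ((tendsto_const_nhds (x := x)).inner (hA.tendsto_res_atTop hT hdense x))
    rwa [inner_zero_right, Complex.zero_re] at h
  have hdiff (t : ℝ) : (inner ℂ x (hT.resDiff t x)).re =
      (inner ℂ x (hT.res t x)).re - (inner ℂ x (hT.res (2 * t) x)).re := by
    rw [hT.resDiff_apply, inner_sub_right, Complex.sub_re]
  have hanti (t : ℝ) (ht : 0 < t) :
      (inner ℂ x (hT.res (2 * t) x)).re ≤ (inner ℂ x (hT.res t x)).re := by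
    rw [← sub_nonneg, ← hdiff]
    exact hA.re_inner_resDiff_nonneg hT ht x
  simp only [hdiff]
  rw [lintegral_mulHaar_sub_comp_mul_left hcont.continuousOn two_pos hanti hzero htop, sub_zero]

theorem lintegral_re_inner_resDiff_le (hA : IsGenerator T (-A))
    (hdense : Dense (opRange A : Set X)) (x : X) :
    ∫⁻ t, ENNReal.ofReal (inner ℂ x (hT.resDiff t x)).re ∂mulHaar ≤
      37 * ∫⁻ t, ‖hT.resDiff t x‖ₑ ^ 2 ∂mulHaar := by
  let q (t : ℝ) : ℝ≥0∞ := ENNReal.ofReal (inner ℂ x (hT.resDiff t x)).re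
  have hq : Measurable q := (Complex.continuous_re.comp
    (continuous_const.inner (hT.continuous_resDiff x))).measurable.ennreal_ofReal
  have hfin : ∫⁻ t, q t ∂mulHaar ≠ ∞ := by
    rw [hA.lintegral_re_inner_resDiff hT hdense]
    exact ENNReal.ofReal_ne_top
  have hpoint : ∀ᵐ t ∂mulHaar, 10 * q (2 * t) ≤
      5 * q t + 4 * q (4 * t) + 37 * ‖hT.resDiff (4 * t) x‖ₑ ^ 2 := by
    filter_upwards [ae_mulHaar_pos] with t ht
    have hq0 := hA.re_inner_resDiff_nonneg hT ht x
    have hq4 := hA.re_inner_resDiff_nonneg hT (mul_pos four_pos ht) x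
    have h := ENNReal.ofReal_le_ofReal (hA.ten_mul_re_inner_resDiff_le hT ht x)
    rwa [ENNReal.ofReal_add (by positivity) (by positivity),
      ENNReal.ofReal_add (by positivity) (by positivity), ENNReal.ofReal_mul (by positivity),
      ENNReal.ofReal_mul (by positivity), ENNReal.ofReal_mul (by positivity),
      ENNReal.ofReal_mul (by positivity), ENNReal.ofReal_pow (norm_nonneg _), ofReal_norm,
      ENNReal.ofReal_ofNat, ENNReal.ofReal_ofNat, ENNReal.ofReal_ofNat,
      ENNReal.ofReal_ofNat] at h
  have hint := lintegral_mono_ae hpoint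
  rw [lintegral_const_mul' _ _ (by finiteness), lintegral_add_left (by fun_prop),
    lintegral_add_left (by fun_prop), lintegral_const_mul' _ _ (by finiteness),
    lintegral_const_mul' _ _ (by finiteness), lintegral_const_mul' _ _ (by finiteness),
    lintegral_mulHaar_comp_mul_left two_pos, lintegral_mulHaar_comp_mul_left four_pos,
    lintegral_mulHaar_comp_mul_left four_pos fun t => ‖hT.resDiff t x‖ₑ ^ 2] at hint
  have hsplit (a : ℝ≥0∞) : 10 * a = 5 * a + 4 * a + a := by ring
  rw [hsplit] at hint
  exact (ENNReal.add_le_add_iff_left (by finiteness)).1 hint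

theorem enorm_sq_le_lintegral_flowDiff (hT : IsContractionSemigroup T) (hA : IsGenerator T (-A))
    (hdense : Dense (opRange A : Set X)) (x : X) :
    ‖x‖ₑ ^ 2 ≤ 74 * ∫⁻ t, ‖flowDiff T t x‖ₑ ^ 2 ∂mulHaar := by
  have hlog : (1 : ℝ) ≤ 2 * Real.log 2 := by linarith [Real.log_two_gt_d9]
  calc ‖x‖ₑ ^ 2 ≤ ENNReal.ofReal (2 * Real.log 2 * ‖x‖ ^ 2) := by
        rw [← ofReal_norm, ← ENNReal.ofReal_pow (norm_nonneg x)]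
        exact ENNReal.ofReal_le_ofReal (le_mul_of_one_le_left (sq_nonneg _) hlog)
    _ = 2 * ∫⁻ t, ENNReal.ofReal (inner ℂ x (hT.resDiff t x)).re ∂mulHaar := by
        rw [hA.lintegral_re_inner_resDiff hT hdense, mul_assoc, ENNReal.ofReal_mul zero_le_two,
          ENNReal.ofReal_ofNat]
    _ ≤ 2 * (37 * ∫⁻ t, ‖flowDiff T t x‖ₑ ^ 2 ∂mulHaar) := by
        refine mul_le_mul' le_rfl ((hA.lintegral_re_inner_resDiff_le hT hdense x).trans ?_)
        exact mul_le_mul' le_rfl (hT.lintegral_enorm_sq_resDiff_le x)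
    _ = 74 * ∫⁻ t, ‖flowDiff T t x‖ₑ ^ 2 ∂mulHaar := by
        rw [← mul_assoc]; norm_num

end IsGenerator

end SquareFunction

section BalakrishnanKernel

/-- The kernel `κ σ` with `(1 + (t / σ) A)⁻¹ (T(t) - T(2t)) = ∫_0^∞ κ σ w • T(t (1 + w)) dw` for
every `t > 0`. -/
def diffKernel (σ w : ℝ) : ℝ :=
  σ * Real.exp (-(σ * w)) - (Ioi 1).indicator (fun v => σ * Real.exp (-(σ * (v - 1)))) w

theorem measurable_diffKernel : Measurable (Function.uncurry diffKernel) := by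
  have hind : (fun p : ℝ × ℝ =>
      (Ioi 1).indicator (fun v => p.1 * Real.exp (-(p.1 * (v - 1)))) p.2) =
        (Prod.snd ⁻¹' Ioi 1).indicator fun p => p.1 * Real.exp (-(p.1 * (p.2 - 1))) := rfl
  have hmeas : Measurable fun p : ℝ × ℝ =>
      (Ioi 1).indicator (fun v => p.1 * Real.exp (-(p.1 * (v - 1)))) p.2 := by
    rw [hind]
    exact Measurable.indicator (by fun_prop) (measurable_snd measurableSet_Ioi)
  exact Measurable.sub (by fun_prop) hmeas

theorem integrableOn_mul_exp_Ioi {σ : ℝ} (hσ : 0 < σ) (c : ℝ) :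
    IntegrableOn (fun w => σ * Real.exp (-(σ * w))) (Ioi c) := by
  have h := (integrableOn_exp_mul_Ioi (neg_neg_of_pos hσ) c).const_mul σ
  simp only [neg_mul] at h
  exact h

theorem lintegral_mul_exp_Ioi {σ : ℝ} (hσ : 0 < σ) (c : ℝ) :
    ∫⁻ w in Ioi c, ENNReal.ofReal (σ * Real.exp (-(σ * w))) =
      ENNReal.ofReal (Real.exp (-(σ * c))) := by
  rw [← ofReal_integral_eq_lintegral_ofReal (integrableOn_mul_exp_Ioi hσ c)
    (ae_of_all _ fun w => by positivity), integral_const_mul]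
  simp only [← neg_mul]
  rw [integral_exp_mul_Ioi (neg_neg_of_pos hσ), neg_div_neg_eq, mul_div_cancel₀ _ hσ.ne']

theorem lintegral_Ioi_zero_eq_add (f : ℝ → ℝ≥0∞) :
    ∫⁻ w in Ioi (0 : ℝ), f w = (∫⁻ w in Ioc (0 : ℝ) 1, f w) + ∫⁻ w in Ioi (1 : ℝ), f w := by
  rw [← lintegral_union measurableSet_Ioi (Ioc_disjoint_Ioi le_rfl),
    Ioc_union_Ioi_eq_Ioi zero_le_one]

theorem setLIntegral_Ioc_enorm_diffKernel {σ : ℝ} (hσ : 0 < σ) :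
    ∫⁻ w in Ioc (0 : ℝ) 1, ‖diffKernel σ w‖ₑ = ENNReal.ofReal (1 - Real.exp (-σ)) := by
  have hker : ∀ w ∈ Ioc (0 : ℝ) 1,
      ‖diffKernel σ w‖ₑ = ENNReal.ofReal (σ * Real.exp (-(σ * w))) := by
    intro w hw
    rw [diffKernel, indicator_of_notMem (notMem_Ioi.2 hw.2), sub_zero,
      Real.enorm_eq_ofReal (by positivity)]
  have htotal := lintegral_Ioi_zero_eq_add fun w => ENNReal.ofReal (σ * Real.exp (-(σ * w)))
  rw [lintegral_mul_exp_Ioi hσ, lintegral_mul_exp_Ioi hσ, mul_zero, neg_zero, Real.exp_zero,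
    mul_one] at htotal
  rw [setLIntegral_congr_fun measurableSet_Ioc hker, ENNReal.ofReal_sub _ (Real.exp_pos _).le]
  exact ENNReal.eq_sub_of_add_eq ENNReal.ofReal_ne_top htotal.symm

theorem setLIntegral_Ioi_one_enorm_diffKernel {σ : ℝ} (hσ : 0 < σ) :
    ∫⁻ w in Ioi (1 : ℝ), ‖diffKernel σ w‖ₑ = ENNReal.ofReal (1 - Real.exp (-σ)) := by
  have hnonneg : 0 ≤ Real.exp σ - 1 := sub_nonneg.2 (Real.one_le_exp hσ.le)
  have hker : ∀ w ∈ Ioi (1 : ℝ), ‖diffKernel σ w‖ₑ =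
      ENNReal.ofReal (Real.exp σ - 1) * ENNReal.ofReal (σ * Real.exp (-(σ * w))) := by
    intro w hw
    have hexp : diffKernel σ w = -((Real.exp σ - 1) * (σ * Real.exp (-(σ * w)))) := by
      rw [diffKernel, indicator_of_mem hw, mul_sub, neg_sub, mul_one, sub_eq_add_neg σ,
        Real.exp_add]
      ring
    rw [hexp, enorm_neg, Real.enorm_eq_ofReal (by positivity), ENNReal.ofReal_mul hnonneg]
  rw [setLIntegral_congr_fun measurableSet_Ioi hker,
    lintegral_const_mul' _ _ ENNReal.ofReal_ne_top, lintegral_mul_exp_Ioi hσ,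
    ← ENNReal.ofReal_mul hnonneg, mul_one, sub_mul, ← Real.exp_add, add_neg_cancel,
    Real.exp_zero, one_mul]

theorem lintegral_enorm_diffKernel {σ : ℝ} (hσ : 0 < σ) :
    ∫⁻ w in Ioi (0 : ℝ), ‖diffKernel σ w‖ₑ = 2 * ENNReal.ofReal (1 - Real.exp (-σ)) := by
  rw [lintegral_Ioi_zero_eq_add, setLIntegral_Ioc_enorm_diffKernel hσ,
    setLIntegral_Ioi_one_enorm_diffKernel hσ, two_mul]

/-- The kernel, relative to `t^{1/2} T(t (1 + w)) dw`, by which Balakrishnan's integral bounds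
`A^{-1/2} (T(t) - T(2t))`. -/
def sqrtKernel (w : ℝ) : ℝ≥0∞ :=
  ∫⁻ σ in Ioi (0 : ℝ), ENNReal.ofReal (σ ^ (-(3 / 2) : ℝ)) * ‖diffKernel σ w‖ₑ

theorem measurable_rpow_mul_diffKernel : Measurable fun p : ℝ × ℝ =>
    ENNReal.ofReal (p.1 ^ (-(3 / 2) : ℝ)) * ‖diffKernel p.1 p.2‖ₑ :=
  Measurable.mul (by fun_prop) measurable_diffKernel.enorm

theorem measurable_sqrtKernel : Measurable sqrtKernel :=
  Measurable.lintegral_prod_left' measurable_rpow_mul_diffKernel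

theorem lintegral_rpow_mul_lintegral_diffKernel_mul {f : ℝ → ℝ≥0∞} (hf : Measurable f) :
    ∫⁻ σ in Ioi (0 : ℝ), ENNReal.ofReal (σ ^ (-(3 / 2) : ℝ)) *
        ∫⁻ w in Ioi (0 : ℝ), ‖diffKernel σ w‖ₑ * f w =
      ∫⁻ w in Ioi (0 : ℝ), sqrtKernel w * f w := by
  have hmeas : Measurable (Function.uncurry fun σ w : ℝ =>
      ENNReal.ofReal (σ ^ (-(3 / 2) : ℝ)) * ‖diffKernel σ w‖ₑ * f w) :=
    measurable_rpow_mul_diffKernel.mul (hf.comp measurable_snd)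
  calc ∫⁻ σ in Ioi (0 : ℝ), ENNReal.ofReal (σ ^ (-(3 / 2) : ℝ)) *
        ∫⁻ w in Ioi (0 : ℝ), ‖diffKernel σ w‖ₑ * f w
      = ∫⁻ σ in Ioi (0 : ℝ), ∫⁻ w in Ioi (0 : ℝ),
          ENNReal.ofReal (σ ^ (-(3 / 2) : ℝ)) * ‖diffKernel σ w‖ₑ * f w := by
        simp only [← lintegral_const_mul' _ _ ENNReal.ofReal_ne_top, mul_assoc]
    _ = ∫⁻ w in Ioi (0 : ℝ), ∫⁻ σ in Ioi (0 : ℝ),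
          ENNReal.ofReal (σ ^ (-(3 / 2) : ℝ)) * ‖diffKernel σ w‖ₑ * f w :=
        lintegral_lintegral_swap hmeas.aemeasurable
    _ = ∫⁻ w in Ioi (0 : ℝ), sqrtKernel w * f w :=
        lintegral_congr fun w => lintegral_mul_const _
          (measurable_rpow_mul_diffKernel.comp measurable_prodMk_right)

theorem lintegral_rpow_mul_one_sub_exp_ne_top :
    ∫⁻ σ in Ioi (0 : ℝ), ENNReal.ofReal (σ ^ (-(3 / 2) : ℝ) * (1 - Real.exp (-σ))) ≠ ∞ := by
  have hlow : ∫⁻ σ in Ioc (0 : ℝ) 1, ENNReal.ofReal (σ ^ (-(3 / 2) : ℝ) * (1 - Real.exp (-σ))) ≤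
      ∫⁻ σ in Ioc (0 : ℝ) 1, ENNReal.ofReal (σ ^ (-(1 / 2) : ℝ)) := by
    refine setLIntegral_mono' measurableSet_Ioc fun σ hσ => ENNReal.ofReal_le_ofReal ?_
    calc σ ^ (-(3 / 2) : ℝ) * (1 - Real.exp (-σ)) ≤ σ ^ (-(3 / 2) : ℝ) * σ := by
          have := Real.one_sub_le_exp_neg σ
          have := Real.rpow_nonneg hσ.1.le (-(3 / 2))
          gcongr
          linarith
      _ = σ ^ (-(1 / 2) : ℝ) := by
          rw [← Real.rpow_add_one hσ.1.ne']
          norm_num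
  have hhigh : ∫⁻ σ in Ioi (1 : ℝ), ENNReal.ofReal (σ ^ (-(3 / 2) : ℝ) * (1 - Real.exp (-σ))) ≤
      ∫⁻ σ in Ioi (1 : ℝ), ENNReal.ofReal (σ ^ (-(3 / 2) : ℝ)) := by
    refine setLIntegral_mono' measurableSet_Ioi fun σ hσ => ENNReal.ofReal_le_ofReal ?_
    have hσ' : (0 : ℝ) ≤ σ := zero_le_one.trans (le_of_lt hσ)
    exact mul_le_of_le_one_right (Real.rpow_nonneg hσ' _) (sub_le_self _ (Real.exp_pos _).le)
  have hint_low : IntegrableOn (fun σ : ℝ => σ ^ (-(1 / 2) : ℝ)) (Ioc 0 1) :=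
    (intervalIntegral.intervalIntegrable_rpow' (by norm_num)).1
  have hint_high : IntegrableOn (fun σ : ℝ => σ ^ (-(3 / 2) : ℝ)) (Ioi 1) :=
    integrableOn_Ioi_rpow_of_lt (by norm_num) one_pos
  rw [lintegral_Ioi_zero_eq_add]
  exact ENNReal.add_ne_top.2
    ⟨(hlow.trans_lt hint_low.lintegral_lt_top).ne, (hhigh.trans_lt hint_high.lintegral_lt_top).ne⟩

theorem lintegral_sqrtKernel_ne_top : ∫⁻ w in Ioi (0 : ℝ), sqrtKernel w ≠ ∞ := by
  have h := lintegral_rpow_mul_lintegral_diffKernel_mul (f := fun _ => 1) measurable_const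
  simp only [mul_one] at h
  have hker : ∀ σ ∈ Ioi (0 : ℝ), ENNReal.ofReal (σ ^ (-(3 / 2) : ℝ)) *
      ∫⁻ w in Ioi (0 : ℝ), ‖diffKernel σ w‖ₑ =
        2 * ENNReal.ofReal (σ ^ (-(3 / 2) : ℝ) * (1 - Real.exp (-σ))) := by
    intro σ hσ
    rw [lintegral_enorm_diffKernel hσ, mul_left_comm,
      ENNReal.ofReal_mul (Real.rpow_nonneg (le_of_lt hσ) _)]
  rw [← h, setLIntegral_congr_fun measurableSet_Ioi hker,
    lintegral_const_mul' _ _ (by finiteness)]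
  exact ENNReal.mul_ne_top (by finiteness) lintegral_rpow_mul_one_sub_exp_ne_top

end BalakrishnanKernel

section BalakrishnanFormula

variable {X : Type*} [NormedAddCommGroup X] [InnerProductSpace ℂ X] {T : ℝ → X →L[ℂ] X}

namespace IsContractionSemigroup

theorem res_div_eq (hT : IsContractionSemigroup T) (t : ℝ) {σ : ℝ} (hσ : 0 < σ) (x : X) :
    hT.res (t / σ) x = ∫ v in Ioi (0 : ℝ), (σ * Real.exp (-(σ * v))) • flow T (t * v) x := by
  have hscale := integral_comp_mul_left_Ioi
    (fun u => Real.exp (-u) • flow T (t / σ * u) x) 0 hσ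
  rw [mul_zero, ← hT.res_apply, eq_inv_smul_iff₀ hσ.ne'] at hscale
  rw [← hscale, ← integral_smul]
  refine integral_congr_ae (ae_of_all _ fun v => ?_)
  simp only [smul_smul, ← mul_assoc, div_mul_cancel₀ t hσ.ne']

theorem res_div_flow_mul (hT : IsContractionSemigroup T) {t c σ : ℝ}
    (ht : 0 ≤ t) (hc : 0 ≤ c) (hσ : 0 < σ) (x : X) : hT.res (t / σ) (flow T (c * t) x) =
      ∫ v in Ioi (0 : ℝ), (σ * Real.exp (-(σ * v))) • flow T (t * (c + v)) x := by
  rw [hT.res_div_eq t hσ]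
  refine setIntegral_congr_fun measurableSet_Ioi fun v hv => ?_
  have hv' : 0 ≤ t * v := mul_nonneg ht (le_of_lt hv)
  have hadd : t * (c + v) = t * v + c * t := by ring
  rw [hadd, hT.flow_add hv' (mul_nonneg hc ht)]

theorem res_div_flowDiff (hT : IsContractionSemigroup T) {t σ : ℝ}
    (ht : 0 ≤ t) (hσ : 0 < σ) (x : X) : hT.res (t / σ) (flowDiff T t x) =
      ∫ w in Ioi (0 : ℝ), diffKernel σ w • flow T (t * (1 + w)) x := by
  have hshift : ∫ v in Ioi (0 : ℝ), (σ * Real.exp (-(σ * v))) • flow T (t * (2 + v)) x =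
      ∫ w in Ioi (0 : ℝ),
        (Ioi 1).indicator (fun v => σ * Real.exp (-(σ * (v - 1)))) w • flow T (t * (1 + w)) x := by
    have htranslate := setIntegral_Ioi_comp_add_right
      (fun w => (σ * Real.exp (-(σ * (w - 1)))) • flow T (t * (1 + w)) x) 0 1
    simp only [add_sub_cancel_right, zero_add, add_left_comm (1 : ℝ), one_add_one_eq_two]
      at htranslate
    simp only [← indicator_smul_apply_left (Ioi 1) (fun v => σ * Real.exp (-(σ * (v - 1))))
      fun w => flow T (t * (1 + w)) x]
    rw [setIntegral_indicator measurableSet_Ioi, Ioi_inter_Ioi, max_eq_right zero_le_one,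
      ← htranslate]
    simp only [add_comm]
  have hint := integrableOn_mul_exp_Ioi hσ 0
  have hint_shift : IntegrableOn (fun v => σ * Real.exp (-(σ * (v - 1)))) (Ioi 0) := by
    refine (hint.const_mul (Real.exp σ)).congr (ae_of_all _ fun v => ?_)
    simp only
    rw [mul_left_comm, ← Real.exp_add]
    ring_nf
  have hone := hT.res_div_flow_mul ht zero_le_one hσ x
  rw [one_mul] at hone
  have hcont : Continuous fun w : ℝ => t * (1 + w) := by fun_prop
  rw [flowDiff_apply, map_sub, hone, hT.res_div_flow_mul ht zero_le_two hσ, hshift,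
    ← integral_sub (hT.integrable_smul_flow hint hcont x)
      (hT.integrable_smul_flow (hint_shift.indicator measurableSet_Ioi) hcont x)]
  simp only [← sub_smul, diffKernel]

/-- The integrand of Balakrishnan's formula for `A^{-1/2} x`, where `-A` is the generator of
`T`. -/
def sqrtIntegrand (hT : IsContractionSemigroup T) (x : X) (s : ℝ) : X :=
  s ^ (-(3 / 2) : ℝ) • hT.res s⁻¹ x

theorem continuousOn_sqrtIntegrand (hT : IsContractionSemigroup T) (x : X) :
    ContinuousOn (hT.sqrtIntegrand x) (Ioi 0) :=
  (continuousOn_id.rpow_const fun _ hs => Or.inl (ne_of_gt hs)).smul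
    ((hT.continuous_res x).comp_continuousOn (continuousOn_inv₀.mono fun _ hs => ne_of_gt hs))

variable {Y : Type*} [NormedAddCommGroup Y] [NormedSpace ℂ Y]

theorem lintegral_enorm_map_sqrtIntegrand_le [CompleteSpace X] (hT : IsContractionSemigroup T)
    (L : X →L[ℂ] Y) {t : ℝ} (ht : 0 < t) (x : X) :
    ∫⁻ s in Ioi (0 : ℝ), ‖L (hT.sqrtIntegrand (flowDiff T t x) s)‖ₑ ≤
      ENNReal.ofReal (t ^ (1 / 2 : ℝ)) *
        ∫⁻ w in Ioi (0 : ℝ), sqrtKernel w * ‖L (flow T (t * (1 + w)) x)‖ₑ := by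
  have hres {s : ℝ} (hs : 0 < s) : ‖L (hT.res s⁻¹ (flowDiff T t x))‖ₑ ≤
      ∫⁻ w in Ioi (0 : ℝ), ‖diffKernel (t * s) w‖ₑ * ‖L (flow T (t * (1 + w)) x)‖ₑ := by
    have h := hT.res_div_flowDiff ht.le (mul_pos ht hs) x
    rw [div_mul_cancel_left₀ ht.ne'] at h
    rw [h]
    refine (enorm_map_integral_le L _).trans_eq (lintegral_congr fun w => ?_)
    rw [ContinuousLinearMap.map_smul_of_tower, enorm_smul]
  have hmeas : Measurable fun w => ‖L (flow T (t * (1 + w)) x)‖ₑ :=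
    (L.continuous.comp ((hT.continuous_flow x).comp (by fun_prop))).enorm.measurable
  have hrpow {s : ℝ} (hs : 0 < s) :
      s ^ (-(3 / 2) : ℝ) = t ^ (3 / 2 : ℝ) * (t * s) ^ (-(3 / 2) : ℝ) := by
    rw [Real.mul_rpow ht.le hs.le, ← mul_assoc, ← Real.rpow_add ht, add_neg_cancel,
      Real.rpow_zero, one_mul]
  have ht_rpow : t ^ (3 / 2 : ℝ) * t⁻¹ = t ^ (1 / 2 : ℝ) := by
    rw [← Real.rpow_neg_one, ← Real.rpow_add ht]
    norm_num
  calc ∫⁻ s in Ioi (0 : ℝ), ‖L (hT.sqrtIntegrand (flowDiff T t x) s)‖ₑ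
      ≤ ∫⁻ s in Ioi (0 : ℝ), ENNReal.ofReal (t ^ (3 / 2 : ℝ)) *
          (ENNReal.ofReal ((t * s) ^ (-(3 / 2) : ℝ)) *
            ∫⁻ w in Ioi (0 : ℝ), ‖diffKernel (t * s) w‖ₑ * ‖L (flow T (t * (1 + w)) x)‖ₑ) := by
        refine setLIntegral_mono' measurableSet_Ioi fun s hs => ?_
        rw [sqrtIntegrand, ContinuousLinearMap.map_smul_of_tower, enorm_smul,
          Real.enorm_eq_ofReal (Real.rpow_nonneg (le_of_lt hs) _), hrpow hs,
          ENNReal.ofReal_mul (by positivity), mul_assoc]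
        exact mul_le_mul' le_rfl (mul_le_mul' le_rfl (hres hs))
    _ = ENNReal.ofReal (t ^ (1 / 2 : ℝ)) *
          ∫⁻ w in Ioi (0 : ℝ), sqrtKernel w * ‖L (flow T (t * (1 + w)) x)‖ₑ := by
        rw [lintegral_const_mul' _ _ ENNReal.ofReal_ne_top,
          lintegral_comp_mul_left_Ioi ht fun σ => ENNReal.ofReal (σ ^ (-(3 / 2) : ℝ)) *
            ∫⁻ w in Ioi (0 : ℝ), ‖diffKernel σ w‖ₑ * ‖L (flow T (t * (1 + w)) x)‖ₑ,
          lintegral_rpow_mul_lintegral_diffKernel_mul hmeas, ← mul_assoc,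
          ← ENNReal.ofReal_mul (by positivity), ht_rpow]

theorem integrableOn_sqrtIntegrand [CompleteSpace X] (hT : IsContractionSemigroup T) {t : ℝ}
    (ht : 0 < t) (x : X) :
    IntegrableOn (hT.sqrtIntegrand (flowDiff T t x)) (Ioi 0) := by
  refine ⟨(hT.continuousOn_sqrtIntegrand _).aestronglyMeasurable measurableSet_Ioi, ?_⟩
  have hbound : ∫⁻ w in Ioi (0 : ℝ), sqrtKernel w * ‖flow T (t * (1 + w)) x‖ₑ ≤
      (∫⁻ w in Ioi (0 : ℝ), sqrtKernel w) * ‖x‖ₑ := by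
    rw [← lintegral_mul_const _ measurable_sqrtKernel]
    exact lintegral_mono fun w =>
      mul_le_mul' le_rfl (enorm_le_iff_norm_le.2 (hT.norm_flow_apply_le _ x))
  have hfin := lintegral_sqrtKernel_ne_top
  exact ((hT.lintegral_enorm_map_sqrtIntegrand_le (ContinuousLinearMap.id ℂ X) ht x).trans
    (mul_le_mul' le_rfl hbound)).trans_lt (by finiteness)

theorem lintegral_sq_lintegral_sqrtKernel_mul_le (hT : IsContractionSemigroup T) (L : X →L[ℂ] Y)
    (x : X) :
    ∫⁻ t in Ioi (0 : ℝ), (∫⁻ w in Ioi (0 : ℝ), sqrtKernel w * ‖L (flow T (t * (1 + w)) x)‖ₑ) ^ 2 ≤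
      (∫⁻ w in Ioi (0 : ℝ), sqrtKernel w) ^ 2 * ∫⁻ t in Ioi (0 : ℝ), ‖L (flow T t x)‖ₑ ^ 2 := by
  refine lintegral_sq_lintegral_mul_le (g := fun w t => ‖L (flow T (t * (1 + w)) x)‖ₑ)
    measurable_sqrtKernel ?_ ?_
  · exact (L.continuous.comp ((hT.continuous_flow x).comp (by fun_prop))).enorm.measurable
  · filter_upwards [ae_restrict_mem measurableSet_Ioi] with w hw
    have hw' : 0 < 1 + w := add_pos one_pos hw
    simp only [mul_comm _ (1 + w)]
    rw [lintegral_comp_mul_left_Ioi hw' fun t => ‖L (flow T t x)‖ₑ ^ 2]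
    refine mul_le_of_le_one_left zero_le (ENNReal.ofReal_le_one.2 (inv_le_one_of_one_le₀ ?_))
    exact le_add_of_nonneg_right (le_of_lt hw)

end IsContractionSemigroup

end BalakrishnanFormula

section Observation

variable {X Y : Type*} [NormedAddCommGroup X] [InnerProductSpace ℂ X]
  [NormedAddCommGroup Y] [NormedSpace ℂ Y] {T : ℝ → X →L[ℂ] X} {A : X →ₗ.[ℂ] X}
  {C : A.domain →ₗ[ℂ] Y}

theorem IsContractionSemigroup.flowDiff_res [CompleteSpace X] (hT : IsContractionSemigroup T)
    (s t : ℝ) (x : X) : flowDiff T t (hT.res s x) = hT.res s (flowDiff T t x) := by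
  simp only [flowDiff_apply, hT.flow_res, map_sub]

theorem isInfiniteTimeExactlyObservable_of_le {m : ℝ} (hm : 0 < m)
    (h : ∀ x ∈ A.domain, ENNReal.ofReal (m ^ 2 * ‖x‖ ^ 2) ≤ outputEnergy A C T x) :
    IsInfiniteTimeExactlyObservable A C T := by
  have hpos : 0 < ENNReal.ofReal (m ^ 2) := ENNReal.ofReal_pos.2 (by positivity)
  refine hpos.trans_le (le_iInf fun x => le_iInf fun hx => le_iInf fun hnorm => ?_)
  simpa only [hnorm, one_pow, mul_one] using h x hx

theorem exists_pos_ofReal_sq_mul_le {E : Type*} [SeminormedAddCommGroup E] {δ : ℝ} (hδ : 0 < δ)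
    {κ : ℝ≥0∞} (hκ : κ ≠ ∞) :
    ∃ m : ℝ, 0 < m ∧ ∀ (x : E) (e : ℝ≥0∞), ENNReal.ofReal δ ^ 2 * ‖x‖ₑ ^ 2 ≤ κ * e →
      ENNReal.ofReal (m ^ 2 * ‖x‖ ^ 2) ≤ e := by
  have hpos : 0 < κ.toReal + 1 := by positivity
  refine ⟨δ / √(κ.toReal + 1), by positivity, fun x e h => ?_⟩
  have hκ_le : κ ≤ ENNReal.ofReal (κ.toReal + 1) :=
    (ENNReal.le_ofReal_iff_toReal_le hκ hpos.le).2 (le_add_of_nonneg_right zero_le_one)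
  rw [div_pow, Real.sq_sqrt hpos.le, div_mul_eq_mul_div, ENNReal.ofReal_div_of_pos hpos,
    ENNReal.ofReal_mul (by positivity), ENNReal.ofReal_pow hδ.le,
    ENNReal.ofReal_pow (norm_nonneg x), ofReal_norm]
  exact ENNReal.div_le_of_le_mul' (h.trans (mul_le_mul' hκ_le le_rfl))

namespace IsGenerator

variable [CompleteSpace X] (hT : IsContractionSemigroup T)

theorem flowDiff_mem_opRange (hT : IsContractionSemigroup T) (hA : IsGenerator T (-A)) {t : ℝ}
    (ht : 0 ≤ t) (x : X) : flowDiff T t x ∈ opRange A := by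
  have h := (opRange A).sub_mem (hA.flow_sub_self_mem_opRange hT ht x)
    (hA.flow_sub_self_mem_opRange hT (mul_nonneg zero_le_two ht) x)
  rwa [sub_sub_sub_cancel_right] at h

theorem negSqrt_eq (hA : IsGenerator T (-A)) (x : X) :
    negSqrt A x = Real.pi⁻¹ • ∫ s in Ioi (0 : ℝ), hT.sqrtIntegrand x s := by
  refine congrArg _ (setIntegral_congr_fun measurableSet_Ioi fun s (hs : 0 < s) => ?_)
  simp only [IsContractionSemigroup.sqrtIntegrand]
  rw [hA.resolventAt_eq hT hs, smul_smul, ← Real.rpow_neg_one, ← Real.rpow_add hs]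
  norm_num

theorem negSqrt_flowDiff_res (hA : IsGenerator T (-A)) {t : ℝ} (ht : 0 < t) (y : X) :
    negSqrt A (flowDiff T t (hT.res 1 y)) =
      hT.res 1 (Real.pi⁻¹ • ∫ s in Ioi (0 : ℝ), hT.sqrtIntegrand (flowDiff T t y) s) := by
  rw [hA.negSqrt_eq hT, ContinuousLinearMap.map_smul_of_tower,
    ← ContinuousLinearMap.integral_comp_comm _ (hT.integrableOn_sqrtIntegrand ht y)]
  simp only [IsContractionSemigroup.sqrtIntegrand, hT.flowDiff_res,
    ContinuousLinearMap.map_smul_of_tower, hT.res_comm 1]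

theorem exists_eq_res_one (hA : IsGenerator T (-A)) {x : X} (hx : x ∈ A.domain) :
    ∃ y, x = hT.res 1 y :=
  ⟨_, hA.eq_res_add_smul hT one_pos (A.mem_graph ⟨x, hx⟩)⟩

theorem exists_clm_eq_comp_res (hA : IsGenerator T (-A)) (hC : IsGraphBounded A C) :
    ∃ L : X →L[ℂ] Y, ∀ y, L y = C ⟨hT.res 1 y, hA.res_mem_domain hT one_pos y⟩ := by
  obtain ⟨K, hK⟩ := hC
  let J : X →ₗ[ℂ] A.domain :=
    (hT.res 1).toLinearMap.codRestrict A.domain fun y => hA.res_mem_domain hT one_pos y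
  refine ⟨LinearMap.mkContinuous (C.comp J) (|K| * 3) fun y => ?_, fun y => rfl⟩
  obtain ⟨z, hz, hAz⟩ := (LinearPMap.mem_graph_iff _).1 (hA.res_mem_graph hT one_pos y)
  have hJ : J y = z := Subtype.ext hz.symm
  have hres := hT.norm_res_apply_le 1 y
  have hsub := norm_sub_le y (hT.res 1 y)
  calc ‖C (J y)‖ ≤ K * (‖hT.res 1 y‖ + ‖y - hT.res 1 y‖) := by
        simpa only [hJ, hz, hAz, inv_one, one_smul] using hK z
    _ ≤ |K| * (3 * ‖y‖) := by
        gcongr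
        · exact le_abs_self K
        · linarith
    _ = |K| * 3 * ‖y‖ := (mul_assoc _ _ _).symm

variable {hT}

theorem outputEnergy_res (hA : IsGenerator T (-A)) {L : X →L[ℂ] Y}
    (hL : ∀ y, L y = C ⟨hT.res 1 y, hA.res_mem_domain hT one_pos y⟩) (y : X) :
    outputEnergy A C T (hT.res 1 y) = ∫⁻ t in Ioi (0 : ℝ), ‖L (flow T t y)‖ₑ ^ 2 := by
  refine setLIntegral_congr_fun measurableSet_Ioi fun t ht => ?_
  have ht' : 0 ≤ t := le_of_lt ht
  have hmem := hA.apply_mem_domain hT (hA.res_mem_domain hT one_pos y) ht'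
  have hcomm : T t (hT.res 1 y) = hT.res 1 (flow T t y) := by
    rw [← flow_of_nonneg (T := T) ht', hT.flow_res]
  simp only [output, dif_pos hmem, hL, hcomm]

theorem ofReal_mul_enorm_flowDiff_res_le (hA : IsGenerator T (-A)) {L : X →L[ℂ] Y}
    (hL : ∀ y, L y = C ⟨hT.res 1 y, hA.res_mem_domain hT one_pos y⟩) {δ : ℝ} (hδ : 0 ≤ δ)
    (hlower : ∀ x ∈ A.domain, x ∈ opRange A → ∀ h : negSqrt A x ∈ A.domain,
      δ * ‖x‖ ≤ ‖C ⟨negSqrt A x, h⟩‖) {t : ℝ} (ht : 0 < t) (y : X) :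
    ENNReal.ofReal δ * ‖flowDiff T t (hT.res 1 y)‖ₑ ≤ ENNReal.ofReal (t ^ (1 / 2 : ℝ)) *
      ∫⁻ w in Ioi (0 : ℝ), sqrtKernel w * ‖L (flow T (t * (1 + w)) y)‖ₑ := by
  set z := flowDiff T t (hT.res 1 y)
  set v := ∫ s in Ioi (0 : ℝ), hT.sqrtIntegrand (flowDiff T t y) s
  have hsqrt : negSqrt A z = hT.res 1 (Real.pi⁻¹ • v) := hA.negSqrt_flowDiff_res hT ht y
  have hdom : z ∈ A.domain := by
    simp only [z, hT.flowDiff_res]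
    exact hA.res_mem_domain hT one_pos _
  have hdom_sqrt : negSqrt A z ∈ A.domain := hsqrt ▸ hA.res_mem_domain hT one_pos _
  have hCL : C ⟨negSqrt A z, hdom_sqrt⟩ = Real.pi⁻¹ • L v := by
    rw [← ContinuousLinearMap.map_smul_of_tower, hL]
    exact congrArg C (Subtype.ext hsqrt)
  have hpi : Real.pi⁻¹ ≤ 1 := inv_le_one_of_one_le₀ (by linarith [Real.pi_gt_three])
  have hnorm : δ * ‖z‖ ≤ ‖L v‖ := by
    refine (hlower z hdom (hA.flowDiff_mem_opRange hT ht.le _) hdom_sqrt).trans ?_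
    rw [hCL, norm_smul, Real.norm_of_nonneg (by positivity)]
    exact mul_le_of_le_one_left (norm_nonneg _) hpi
  calc ENNReal.ofReal δ * ‖z‖ₑ ≤ ‖L v‖ₑ := by
        rw [← ofReal_norm, ← ofReal_norm, ← ENNReal.ofReal_mul hδ]
        exact ENNReal.ofReal_le_ofReal hnorm
    _ ≤ ∫⁻ s in Ioi (0 : ℝ), ‖L (hT.sqrtIntegrand (flowDiff T t y) s)‖ₑ :=
        enorm_map_integral_le L _
    _ ≤ _ := hT.lintegral_enorm_map_sqrtIntegrand_le L ht y

theorem ofReal_sq_mul_lintegral_flowDiff_res_le (hA : IsGenerator T (-A)) {L : X →L[ℂ] Y}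
    (hL : ∀ y, L y = C ⟨hT.res 1 y, hA.res_mem_domain hT one_pos y⟩) {δ : ℝ} (hδ : 0 ≤ δ)
    (hlower : ∀ x ∈ A.domain, x ∈ opRange A → ∀ h : negSqrt A x ∈ A.domain,
      δ * ‖x‖ ≤ ‖C ⟨negSqrt A x, h⟩‖) (y : X) :
    ENNReal.ofReal δ ^ 2 * ∫⁻ t, ‖flowDiff T t (hT.res 1 y)‖ₑ ^ 2 ∂mulHaar ≤
      (∫⁻ w in Ioi (0 : ℝ), sqrtKernel w) ^ 2 * ∫⁻ t in Ioi (0 : ℝ), ‖L (flow T t y)‖ₑ ^ 2 := by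
  refine le_trans ?_ (hT.lintegral_sq_lintegral_sqrtKernel_mul_le L y)
  rw [lintegral_mulHaar, ← lintegral_const_mul' _ _ (by finiteness)]
  refine setLIntegral_mono' measurableSet_Ioi fun t (ht : 0 < t) => ?_
  have hsq : ENNReal.ofReal t⁻¹ * ENNReal.ofReal (t ^ (1 / 2 : ℝ)) ^ 2 = 1 := by
    rw [← ENNReal.ofReal_pow (by positivity), ← Real.rpow_mul_natCast ht.le,
      ← ENNReal.ofReal_mul (by positivity)]
    norm_num [ht.ne']
  calc ENNReal.ofReal δ ^ 2 * (ENNReal.ofReal t⁻¹ * ‖flowDiff T t (hT.res 1 y)‖ₑ ^ 2)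
      = ENNReal.ofReal t⁻¹ * (ENNReal.ofReal δ * ‖flowDiff T t (hT.res 1 y)‖ₑ) ^ 2 := by ring
    _ ≤ ENNReal.ofReal t⁻¹ * (ENNReal.ofReal (t ^ (1 / 2 : ℝ)) *
          ∫⁻ w in Ioi (0 : ℝ), sqrtKernel w * ‖L (flow T (t * (1 + w)) y)‖ₑ) ^ 2 :=
        mul_le_mul' le_rfl
          (pow_le_pow_left' (hA.ofReal_mul_enorm_flowDiff_res_le hL hδ hlower ht y) 2)
    _ = (∫⁻ w in Ioi (0 : ℝ), sqrtKernel w * ‖L (flow T (t * (1 + w)) y)‖ₑ) ^ 2 := by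
        rw [mul_pow, ← mul_assoc, hsq, one_mul]

theorem ofReal_sq_mul_enorm_sq_le_outputEnergy (hT : IsContractionSemigroup T)
    (hA : IsGenerator T (-A)) (hdense : Dense (opRange A : Set X)) (hC : IsGraphBounded A C)
    {δ : ℝ} (hδ : 0 ≤ δ)
    (hlower : ∀ x ∈ A.domain, x ∈ opRange A → ∀ h : negSqrt A x ∈ A.domain,
      δ * ‖x‖ ≤ ‖C ⟨negSqrt A x, h⟩‖) {x : X} (hx : x ∈ A.domain) :
    ENNReal.ofReal δ ^ 2 * ‖x‖ₑ ^ 2 ≤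
      74 * (∫⁻ w in Ioi (0 : ℝ), sqrtKernel w) ^ 2 * outputEnergy A C T x := by
  obtain ⟨y, rfl⟩ := hA.exists_eq_res_one hT hx
  obtain ⟨L, hL⟩ := hA.exists_clm_eq_comp_res hT hC
  calc ENNReal.ofReal δ ^ 2 * ‖hT.res 1 y‖ₑ ^ 2
      ≤ ENNReal.ofReal δ ^ 2 * (74 * ∫⁻ t, ‖flowDiff T t (hT.res 1 y)‖ₑ ^ 2 ∂mulHaar) :=
        mul_le_mul' le_rfl (hA.enorm_sq_le_lintegral_flowDiff hT hdense _)
    _ = 74 * (ENNReal.ofReal δ ^ 2 * ∫⁻ t, ‖flowDiff T t (hT.res 1 y)‖ₑ ^ 2 ∂mulHaar) :=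
        mul_left_comm _ _ _
    _ ≤ 74 * ((∫⁻ w in Ioi (0 : ℝ), sqrtKernel w) ^ 2 *
          ∫⁻ t in Ioi (0 : ℝ), ‖L (flow T t y)‖ₑ ^ 2) :=
        mul_le_mul' le_rfl (hA.ofReal_sq_mul_lintegral_flowDiff_res_le hL hδ hlower y)
    _ = 74 * (∫⁻ w in Ioi (0 : ℝ), sqrtKernel w) ^ 2 * outputEnergy A C T (hT.res 1 y) := by
        rw [hA.outputEnergy_res hL, mul_assoc]

end IsGenerator

end Observation

end Observability

end

theorem mainTheorem3_general {X Y : Type*} [NormedAddCommGroup X] [InnerProductSpace ℂ X]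
    [CompleteSpace X] [NormedAddCommGroup Y] [NormedSpace ℂ Y]
    (T : ℝ → X →L[ℂ] X) (hT : Observability.IsContractionSemigroup T)
    (A : X →ₗ.[ℂ] X) (hA : Observability.IsGenerator T (-A))
    (hdense : Dense (Observability.opRange A : Set X))
    (C : A.domain →ₗ[ℂ] Y) (hC : Observability.IsGraphBounded A C)
    (δ : ℝ) (hδ : 0 < δ)
    (hlower : ∀ x : X, x ∈ A.domain → x ∈ Observability.opRange A →
      ∀ h : Observability.negSqrt A x ∈ A.domain,
        δ * ‖x‖ ≤ ‖C ⟨Observability.negSqrt A x, h⟩‖) :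
    (∃ m : ℝ, 0 < m ∧ ∀ x : X, x ∈ A.domain →
      ENNReal.ofReal (m ^ 2 * ‖x‖ ^ 2) ≤ Observability.outputEnergy A C T x) ∧
    Observability.IsInfiniteTimeExactlyObservable A C T := by
  have hkernel := Observability.lintegral_sqrtKernel_ne_top
  obtain ⟨m, hm, hscale⟩ := Observability.exists_pos_ofReal_sq_mul_le (E := X) hδ
    (κ := 74 * (∫⁻ w in Set.Ioi (0 : ℝ), Observability.sqrtKernel w) ^ 2) (by finiteness)
  have hbound : ∀ x ∈ A.domain,
      ENNReal.ofReal (m ^ 2 * ‖x‖ ^ 2) ≤ Observability.outputEnergy A C T x := fun x hx =>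
    hscale x _ (hA.ofReal_sq_mul_enorm_sq_le_outputEnergy hT hdense hC hδ.le hlower hx)
  exact ⟨⟨m, hm, hbound⟩, Observability.isInfiniteTimeExactlyObservable_of_le hm hbound⟩

theorem mainTheorem3 {X Y : Type*} [NormedAddCommGroup X] [InnerProductSpace ℂ X]
    [CompleteSpace X] [NormedAddCommGroup Y] [NormedSpace ℂ Y] [CompleteSpace Y]
    (T : ℝ → X →L[ℂ] X) (hT : Observability.IsContractionSemigroup T)
    (A : X →ₗ.[ℂ] X) (hA : Observability.IsGenerator T (-A))
    (hdense : Dense (Observability.opRange A : Set X))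
    (C : A.domain →ₗ[ℂ] Y) (hC : Observability.IsGraphBounded A C)
    (δ : ℝ) (hδ : 0 < δ)
    (hlower : ∀ x : X, x ∈ A.domain → x ∈ Observability.opRange A →
      ∀ h : Observability.negSqrt A x ∈ A.domain,
        δ * ‖x‖ ≤ ‖C ⟨Observability.negSqrt A x, h⟩‖) :
    (∃ m : ℝ, 0 < m ∧ ∀ x : X, x ∈ A.domain → x ∈ Observability.opRange A →
      ENNReal.ofReal (m ^ 2 * ‖x‖ ^ 2) ≤ Observability.outputEnergy A C T x) ∧
    (Observability.IsBoundedlyInvertible A ∨ Observability.IsInfiniteTimeAdmissible A C T →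
      Observability.IsInfiniteTimeExactlyObservable A C T) := by
  obtain ⟨⟨m, hm, hbound⟩, hobs⟩ := mainTheorem3_general T hT A hA hdense C hC δ hδ hlower
  exact ⟨⟨m, hm, fun x hx _ => hbound x hx⟩, fun _ => hobs⟩
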